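/- **Setting.** Let $X$ be a finite domain and $g:X^*\to\mathbb R$. A real $z$ is *$\alpha$-accurate* for $y\in\mathbb R$, written $z\in(1\pm\alpha)\cdot y$, if $|z-y|\le\alpha|y|$. The *space* of an algorithm is the number of bits needed to store its memory state, i.e. $\lceil\log_2(\text{number of memory states})\rceil$. *Oblivious linear-state algorithms.* Let $\mathcal A$ be a streaming algorithm that processes pairs $(x,q)\in X\times\{0,1\}$ (an update and a query demand) and whose memory has three segments: $S_R$, drawn at random at the beginning and then kept fixed; $S_v$, holding an encoding of a vector of $\mathbb R^d$; and $S_c$, work space. All of its randomness is in $S_R$, and its response to a query is a function of $S_R$ and of the vector encoded in $S_v$. Write $S_v(\vec u)$ for the vector encoded after processing $\vec u\in(X\times\{0,1\})^*$. $\mathcal A$ is *linear state* for stream length $m$ if, for every value of $S_R$ and all $\vec u_1,\vec u_2$ of total length at most $m$, $S_v(\vec u_1\circ\vec u_2)=S_v(\vec u_1)+S_v(\vec u_2)$ (all three executions using the same $S_R$). $\mathcal A$ is *oblivious for $g$ with stream length $m$, accuracy $\alpha$ and failure probability $\beta_0$* if for every fixed $(x_1,\dots,x_m)\in X^m$, when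 $\mathcal A$ is queried in every round, with probability at least $1-\beta_0$ over its coins its responses $z_1,\dots,z_m$ satisfy $z_i\in(1\pm\alpha)\cdot g(x_1,\dots,x_i)$ for all $i$. *The ASA game* with $m$ rounds, at most $T$ queries and query/advice rate $\eta$: in round $i$ the (randomized) adversary, knowing its previous choices and all previous responses, chooses $x_i\in X$ and $q_i\in\{0,1\}$ subject to $\sum_{j\le i}q_j\le T$; the algorithm processes $x_i$; if $q_i=1$, it outputs a response $z_i\in\mathbb R$, which is given to the adversary, and if moreover $\sum_{j\le i}q_j\equiv 0\pmod\eta$, it specifies a predicate $p_i:X^*\to\{0,1\}$ and obtains the bit $p_i(x_1,\dots,x_i)$. The algorithm may use fresh random coins in every step, but between steps it keeps only its memory state, which also determines $p_i$. It is *adversarially robust for $g$ with accuracy $\alpha$ and failure probability $\beta$* if against every adversary, with probability at least $1-\beta$, every response satisfies $z_i\in(1\pm\alpha)\cdot g(x_1,\dots,x_i)$. **Theorem.** For every $c\in\mathbb N$ there is a constant $C>0$, depending only on $c$, such that the following holds. Let $m,\eta\ge1$ and $s\ge 0$ be integers, $\alpha>0$, $0<\beta<1$, let $X$ be a finite domain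 with $|X|\le m^{c}$, and let $g:X^*\to\mathbb R$. Suppose that $\mathcal A$ is a linear-state oblivious streaming algorithm for $g$ with stream length $m$, accuracy $\alpha$ and failure probability $1/10$ that uses space at most $s$. Then there is a streaming algorithm using space at most $$C\cdot\eta\, s^2\,\log\!\left(\frac m\beta\right)\log^2\!\left(\frac m{\beta\alpha}\right)$$ that, for every $T$, is adversarially robust for $g$ in the ASA game with $m$ rounds, at most $T$ queries and query/advice rate $\eta$, with accuracy $\alpha$ and failure probability $\beta$. -/

import Mathlib

namespace Streaming

/-- `z ∈ (1 ± α) · y`: the estimate `z` is within relative error `α` of the true value `y`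
(which may be negative or zero). -/
def Accurate (α y z : ℝ) : Prop := |z - y| ≤ α * |y|

/-- A streaming algorithm over the domain `X` whose memory consists of three segments: `SR`, drawn
at random at the beginning and then kept fixed; `SV`, holding an encoding of a vector of `ℝ ^ d`;
and `SC`, work space for the remaining computations. It processes pairs `(x, q)` of an update and a
query demand. As the work space is not part of the summary of the stream, the response is computed
from the random segment and the encoded vector. -/
structure SegmentedAlgorithm (X : Type*) where
  SR : Type
  SV : Type
  SC : Type
  [fintypeSR : Fintype SR]
  [fintypeSV : Fintype SV]
  [fintypeSC : Fintype SC]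
  d : ℕ
  vec : SV → (Fin d → ℝ)
  coins : PMF SR
  initV : SR → SV
  initC : SR → SC
  update : SR → SV × SC → X × Bool → SV × SC
  respond : SR → (Fin d → ℝ) → ℝ

attribute [instance] SegmentedAlgorithm.fintypeSR SegmentedAlgorithm.fintypeSV
  SegmentedAlgorithm.fintypeSC

namespace SegmentedAlgorithm

variable {X : Type*} (A : SegmentedAlgorithm X)

/-- The number of bits needed to store the whole memory (all three segments). -/
def space : ℕ := Nat.clog 2 (Fintype.card (A.SR × A.SV × A.SC))

/-- The content of the second and third memory segments after processing the stream `u`, when the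
random segment is `r`. -/
def run (r : A.SR) (u : List (X × Bool)) : A.SV × A.SC :=
  u.foldl (A.update r) (A.initV r, A.initC r)

/-- The vector encoded in the second memory segment after processing the stream `u`. -/
def Sv (r : A.SR) (u : List (X × Bool)) : Fin A.d → ℝ := A.vec (A.run r u).1

/-- Linear state, for streams of length at most `m`: with the same random segment in all three
executions, the encoded vector of a concatenation is the sum of the encoded vectors. -/
def IsLinearState (m : ℕ) : Prop :=
  ∀ (r : A.SR) (u₁ u₂ : List (X × Bool)), u₁.length + u₂.length ≤ m →
    A.Sv r (u₁ ++ u₂) = A.Sv r u₁ + A.Sv r u₂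

/-- The response given after the updates `x`, when the algorithm is queried in every round. -/
def output (r : A.SR) (x : List X) : ℝ :=
  A.respond r (A.Sv r (x.map fun a => (a, true)))

/-- Oblivious streaming algorithm for `g` with stream length `m`, accuracy `α` and failure
probability `β`: for every fixed stream of length `m`, all `m` responses are accurate with
probability at least `1 - β` over the coins of the algorithm. -/
def IsOblivious (g : List X → ℝ) (m : ℕ) (α β : ℝ) : Prop :=
  ∀ x : List X, x.length = m →
    ENNReal.ofReal (1 - β) ≤ A.coins.toOuterMeasure
      {r | ∀ i, 1 ≤ i → i ≤ m → Accurate α (g (x.take i)) (A.output r (x.take i))}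

end SegmentedAlgorithm

/-- A record of the rounds played so far, in chronological order: the update of each round, and the
response `some z` if the round was a query (`none` if it was not). -/
abbrev Transcript (X : Type*) := List (X × Option ℝ)

namespace Transcript

variable {X : Type*}

/-- The updates `x₁, x₂, …` of the rounds played so far. -/
def updates (h : Transcript X) : List X := h.map Prod.fst

/-- The number of queries posed so far. -/
def queries (h : Transcript X) : ℕ := h.countP fun p => p.2.isSome

/-- Every response given so far is accurate for the stream up to its round. -/
def AllAccurate (g : List X → ℝ) (α : ℝ) (h : Transcript X) : Prop :=
  ∀ (i : ℕ) (hi : i < h.length) (z : ℝ), (h[i]).2 = some z →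
    Accurate α (g (updates (h.take (i + 1)))) z

end Transcript

/-- A (randomized, adaptive) adversary: from everything it has seen so far it chooses the next
update and query demand. -/
def Adversary (X : Type*) := Transcript X → PMF (X × Bool)

/-- The adversary never poses more than `T` queries. -/
def Adversary.QueryBounded {X : Type*} (B : Adversary X) (T : ℕ) : Prop :=
  ∀ h : Transcript X, h.queries ≤ T → ∀ p ∈ (B h).support, h.queries + p.2.toNat ≤ T

/-- A randomized streaming algorithm with advice. All that it remembers from one step to the next is
an element of the finite type `State`; each step may use fresh coins. -/
structure ASAAlgorithm (X : Type*) where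
  State : Type
  [fintypeState : Fintype State]
  /-- the initial state -/
  init : PMF State
  /-- process an update -/
  update : State → X → PMF State
  /-- respond to a query -/
  answer : State → PMF (ℝ × State)
  /-- the predicate specified when advice is available -/
  predicate : State → List X → Bool
  /-- process the advice bit -/
  receive : State → Bool → PMF State

attribute [instance] ASAAlgorithm.fintypeState

namespace ASAAlgorithm

variable {X : Type*} (A : ASAAlgorithm X)

/-- The number of bits needed to store the state. -/
def space : ℕ := Nat.clog 2 (Fintype.card A.State)

/-- One round of the game with query/advice rate `η`: the adversary chooses an update and a query
demand, the algorithm processes the update; if it is queried it responds, and if moreover the number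
of queries so far is a multiple of `η` it obtains the value of its predicate on the stream so far. -/
noncomputable def round (η : ℕ) (B : Adversary X) (c : A.State × Transcript X) :
    PMF (A.State × Transcript X) :=
  (B c.2).bind fun p =>
    (A.update c.1 p.1).bind fun σ =>
      if p.2 then
        (A.answer σ).bind fun y =>
          let h := c.2 ++ [(p.1, some y.1)]
          if Transcript.queries h % η = 0 then
            (A.receive y.2 (A.predicate y.2 (Transcript.updates h))).map fun τ => (τ, h)
          else PMF.pure (y.2, h)
      else PMF.pure (σ, c.2 ++ [(p.1, none)])

/-- The joint law of the state and the transcript after a given number of rounds. -/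
noncomputable def play (η : ℕ) (B : Adversary X) : ℕ → PMF (A.State × Transcript X)
  | 0 => A.init.map fun σ => (σ, [])
  | n + 1 => (play η B n).bind (A.round η B)

/-- Adversarially robust for `g` in the game with advice with `m` rounds, at most `T` queries and
query/advice rate `η`: against every adversary, with probability at least `1 - β` all responses
given at query times are `α`-accurate. -/
def IsRobust (g : List X → ℝ) (m T η : ℕ) (α β : ℝ) : Prop :=
  ∀ B : Adversary X, B.QueryBounded T →
    ENNReal.ofReal (1 - β) ≤
      (A.play η B m).toOuterMeasure {c | Transcript.AllAccurate g α c.2}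

end ASAAlgorithm

end Streaming

/-! The robust algorithm runs a pool of `k = 100κ` independent copies of the oblivious algorithm and
answers each query by a randomized approximate median of their outputs. The adversary sees only
these answers, and they must not reveal much about any small set of copies. A pool is therefore used
for only one epoch of `Q = η·k·s` queries and is then replaced.

A replacement must know its state vectors on the part of the stream that it missed. Here linearity
and advice meet. The next pool is drawn at the start of an epoch and processes the stream from then
on; its `k` vectors on the earlier prefix, `s` bits each, are requested bit by bit as advice, which
takes exactly one epoch. Linearity adds prefix and suffix vectors. The memory is `O(k·s)` bits.

For the analysis, fix an epoch and a set `J` of `l` copies. There is a response law that ignores `J`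
and satisfies `E[f]² ≤ a·E'[f²]` with `a = 1 + O(u²)` (`exists_mechanism`). These inequalities
compose along the whole adaptive play at a cost of `a` per query of the epoch
(`expect_poolPlay_sq_le`). In the modified play the copies in `J` stay independent of the transcript
during the epoch (`expect_poolPlay_resample`), so they are all bad for the current stream with
probability at most `10⁻ˡ`. Hence in the true play this probability is at most `(a^Q·10⁻ˡ)^(1/2) ≤
(7/20)ˡ` (`expect_forall_bad_sq_le`). Averaging over all `J` shows that more than `43κ` copies are
bad with probability at most `(5/6)ˡ` per epoch (`expect_many_bad_le`). Otherwise any answer with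
more than `43κ` outputs on either side lies between two accurate outputs.

The second moment, rather than a ratio bound per query, gives a loss quadratic in `u`; this allows
`κ` to be linear in `η·s`, whence the space `η·s²·l³` with `l ≈ log(m/β)`. The response law itself
loses no factor `s`: only a number of candidates linear in `s` can ever receive positive weight,
thanks to the cells of a search tree (`exists_cells`). Degenerate parameters are handled by a
constant answer or by storing the stream. -/

open scoped ENNReal

namespace Streaming

/-! ### Expectations of extended nonnegative functions -/

section Expect

variable {α β : Type*}

/-- The expectation of an extended nonnegative function under a discrete distribution. -/
noncomputable def expect (P : PMF α) (f : α → ℝ≥0∞) : ℝ≥0∞ := ∑' a, P a * f a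

theorem expect_mono {P : PMF α} {f g : α → ℝ≥0∞} (h : ∀ a, f a ≤ g a) :
    expect P f ≤ expect P g :=
  ENNReal.tsum_le_tsum fun a => mul_le_mul_right (h a) _

theorem expect_congr_support {P : PMF α} {f g : α → ℝ≥0∞} (h : ∀ a ∈ P.support, f a = g a) :
    expect P f = expect P g := by
  refine tsum_congr fun a => ?_
  by_cases ha : a ∈ P.support
  · rw [h a ha]
  · rw [PMF.mem_support_iff, not_not] at ha
    simp [ha]

theorem expect_const (P : PMF α) (c : ℝ≥0∞) : expect P (fun _ => c) = c := by
  simp [expect, ENNReal.tsum_mul_right, P.tsum_coe]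

theorem expect_le_one {P : PMF α} {f : α → ℝ≥0∞} (h : ∀ a, f a ≤ 1) : expect P f ≤ 1 :=
  (expect_mono h).trans (expect_const P 1).le

theorem expect_pure (a : α) (f : α → ℝ≥0∞) : expect (PMF.pure a) f = f a := by
  classical
  rw [expect, tsum_eq_single a]
  · simp
  · intro b hb
    simp [PMF.pure_apply, hb]

theorem expect_bind (P : PMF α) (K : α → PMF β) (f : β → ℝ≥0∞) :
    expect (P.bind K) f = expect P fun a => expect (K a) f := by
  simp only [expect, PMF.bind_apply, ← ENNReal.tsum_mul_right, ← ENNReal.tsum_mul_left]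
  rw [ENNReal.tsum_comm]
  simp only [mul_assoc]

theorem expect_map (P : PMF α) (φ : α → β) (f : β → ℝ≥0∞) :
    expect (P.map φ) f = expect P fun a => f (φ a) := by
  rw [← PMF.bind_pure_comp, expect_bind]
  simp [expect_pure]

theorem expect_const_mul (P : PMF α) (c : ℝ≥0∞) (f : α → ℝ≥0∞) :
    expect P (fun a => c * f a) = c * expect P f := by
  simp only [expect, ← ENNReal.tsum_mul_left]
  exact tsum_congr fun a => by ring

theorem expect_add (P : PMF α) (f g : α → ℝ≥0∞) :
    expect P (fun a => f a + g a) = expect P f + expect P g := by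
  simp only [expect, mul_add, ENNReal.tsum_add]

theorem expect_finset_sum {ι : Type*} (P : PMF α) (s : Finset ι) (f : ι → α → ℝ≥0∞) :
    expect P (fun a => ∑ i ∈ s, f i a) = ∑ i ∈ s, expect P (f i) := by
  classical
  induction s using Finset.induction_on with
  | empty => simp [expect]
  | insert i s hi ih => simp only [Finset.sum_insert hi, expect_add, ih]

theorem expect_comm (P : PMF α) (P' : PMF β) (f : α → β → ℝ≥0∞) :
    expect P (fun a => expect P' (f a)) = expect P' fun b => expect P fun a => f a b := by
  simp only [expect, ← ENNReal.tsum_mul_left]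
  rw [ENNReal.tsum_comm]
  exact tsum_congr fun b => tsum_congr fun a => by ring

/-- Jensen's inequality, obtained by integrating `2uv ≤ u² + v²` over two independent copies;
infinite values need no separate treatment afterwards. -/
theorem expect_sq_le (P : PMF α) (f : α → ℝ≥0∞) :
    expect P f ^ 2 ≤ expect P fun a => f a ^ 2 := by
  have key : ∀ u v : ℝ≥0∞, 2 * (u * v) ≤ u ^ 2 + v ^ 2 := by
    intro u v
    by_cases hu : u = ⊤
    · simp [hu]
    by_cases hv : v = ⊤
    · simp [hv]
    lift u to NNReal using hu
    lift v to NNReal using hv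
    have := two_mul_le_add_sq u v
    rw [mul_assoc] at this
    exact_mod_cast this
  have h1 : expect P f ^ 2 = expect P fun a => expect P fun b => f a * f b := by
    simp only [expect_const_mul]
    rw [sq, ← expect_const_mul]
    congr 1
    funext a
    rw [mul_comm]
  have h2 : 2 * expect P f ^ 2 ≤ 2 * expect P fun a => f a ^ 2 := by
    rw [h1, ← expect_const_mul]
    simp only [← expect_const_mul]
    refine (expect_mono fun a => expect_mono fun b => key _ _).trans ?_
    simp only [expect_add, expect_const, two_mul, le_refl]
  exact (ENNReal.mul_le_mul_iff_right (by simp) (by simp)).1 h2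

theorem toOuterMeasure_eq_expect (P : PMF α) (S : Set α) :
    P.toOuterMeasure S = expect P (S.indicator 1) := by
  rw [PMF.toOuterMeasure_apply, expect]
  refine tsum_congr fun a => ?_
  by_cases ha : a ∈ S <;> simp [ha]

theorem ofReal_one_sub_le_of_expect_compl_le {P : PMF α} {S : Set α} {b : ℝ} (hb : 0 ≤ b)
    (h : expect P (Sᶜ.indicator 1) ≤ ENNReal.ofReal b) :
    ENNReal.ofReal (1 - b) ≤ P.toOuterMeasure S := by
  rw [toOuterMeasure_eq_expect, ENNReal.ofReal_sub _ hb, ENNReal.ofReal_one]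
  rw [tsub_le_iff_right]
  calc (1 : ℝ≥0∞) = expect P fun a => S.indicator 1 a + Sᶜ.indicator 1 a := by
        have : (fun a => S.indicator (1 : α → ℝ≥0∞) a + Sᶜ.indicator 1 a) = fun _ => 1 := by
          funext a
          by_cases ha : a ∈ S <;> simp [ha]
        rw [this, expect_const]
    _ ≤ _ := by rw [expect_add]; gcongr

theorem bind_congr_support {P : PMF α} {K K' : α → PMF β} (h : ∀ a ∈ P.support, K a = K' a) :
    P.bind K = P.bind K' := by
  ext b
  simp only [PMF.bind_apply]
  refine tsum_congr fun a => ?_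
  by_cases ha : a ∈ P.support
  · rw [h a ha]
  · rw [PMF.mem_support_iff, not_not] at ha
    simp [ha]

end Expect

/-! ### Independent samples and partial resampling -/

section Iid

variable {R : Type*}

/-- The family that agrees with `ρ'` on `J` and with `ρ` elsewhere. -/
def mix {k : ℕ} (J : Finset (Fin k)) (ρ ρ' : Fin k → R) : Fin k → R :=
  fun j => if j ∈ J then ρ' j else ρ j

theorem mix_mix {k : ℕ} (J : Finset (Fin k)) (ρ ρ' ρ'' : Fin k → R) :
    mix J (mix J ρ ρ') ρ'' = mix J ρ ρ'' := by
  funext j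
  by_cases hj : j ∈ J <;> simp [mix, hj]

variable [Fintype R]

theorem sum_coe_eq_one (μ : PMF R) : ∑ r, μ r = 1 := by
  rw [← tsum_fintype (L := .unconditional _)]
  exact μ.tsum_coe

/-- The law of `k` independent samples from `μ`. -/
noncomputable def iid (μ : PMF R) (k : ℕ) : PMF (Fin k → R) :=
  PMF.ofFintype (fun ρ => ∏ j, μ (ρ j)) <| by
    classical
    rw [← Fintype.piFinset_univ, ← Finset.prod_univ_sum]
    simp [sum_coe_eq_one]

theorem expect_iid (μ : PMF R) (k : ℕ) (f : (Fin k → R) → ℝ≥0∞) :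
    expect (iid μ k) f = ∑ ρ, (∏ j, μ (ρ j)) * f ρ := by
  classical
  rw [expect, tsum_fintype]
  rfl

/-- Resampling the coordinates in `J` does not change the law. -/
theorem expect_iid_mix (μ : PMF R) {k : ℕ} (J : Finset (Fin k)) (f : (Fin k → R) → ℝ≥0∞) :
    (expect (iid μ k) fun ρ => expect (iid μ k) fun ρ' => f (mix J ρ ρ')) =
      expect (iid μ k) f := by
  classical
  have h1 : expect (iid μ k) f =
      expect (iid μ k) fun ρ => expect (iid μ k) fun _ => f ρ := by
    simp only [expect_const]
  rw [h1]
  simp only [expect_iid, Finset.mul_sum]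
  rw [← Fintype.sum_prod_type', ← Fintype.sum_prod_type']
  -- Exchanging the coordinates in `J` between two independent families is an involution that
  -- preserves the product weights.
  let e : (Fin k → R) × (Fin k → R) → (Fin k → R) × (Fin k → R) :=
    fun p => (mix J p.1 p.2, mix J p.2 p.1)
  have he : Function.Involutive e := by
    rintro ⟨a, b⟩
    refine Prod.ext ?_ ?_ <;> funext j <;> by_cases hj : j ∈ J <;> simp [e, mix, hj]
  refine Fintype.sum_equiv he.toPerm _ _ ?_
  rintro ⟨a, b⟩
  simp only [Function.Involutive.coe_toPerm, e]
  rw [← mul_assoc, ← mul_assoc, ← Finset.prod_mul_distrib, ← Finset.prod_mul_distrib]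
  congr 1
  refine Finset.prod_congr rfl fun j _ => ?_
  by_cases hj : j ∈ J <;> simp [mix, hj, mul_comm]

theorem expect_iid_prod (μ : PMF R) {k : ℕ} (J : Finset (Fin k)) (F : R → ℝ≥0∞) :
    expect (iid μ k) (fun ρ => ∏ j ∈ J, F (ρ j)) = expect μ F ^ J.card := by
  classical
  have h1 : ∀ ρ : Fin k → R, (∏ j, μ (ρ j)) * ∏ j ∈ J, F (ρ j) =
      ∏ j, μ (ρ j) * (if j ∈ J then F (ρ j) else 1) := by
    intro ρ
    rw [Finset.prod_mul_distrib, Finset.prod_ite_mem, Finset.univ_inter]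
  rw [expect_iid]
  simp only [h1]
  have h2 := Finset.prod_univ_sum (fun _ : Fin k => (Finset.univ : Finset R))
    (fun j r => μ r * (if j ∈ J then F r else 1))
  rw [Fintype.piFinset_univ] at h2
  rw [← h2]
  have h3 : ∀ j, (∑ r, μ r * (if j ∈ J then F r else 1)) =
      if j ∈ J then expect μ F else 1 := by
    intro j
    split_ifs
    · rw [expect, tsum_fintype]
    · simp [sum_coe_eq_one]
  simp only [h3]
  rw [Finset.prod_ite_mem, Finset.univ_inter, Finset.prod_const]

end Iid

/-! ### Medians and search-tree cells -/

section Cells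

open Classical in
-- Take the smallest data value with at least half of the data at or below it. If too few points
-- were at or above it, the largest value strictly below it would already qualify.
theorem exists_median {ι : Type*} (D : Finset ι) (hD : D.Nonempty) (y : ι → ℝ) :
    ∃ j ∈ D, D.card ≤ 2 * (D.filter fun i => y i ≤ y j).card ∧
      D.card ≤ 2 * (D.filter fun i => y j ≤ y i).card := by
  obtain ⟨M, hM, hMmax⟩ := D.exists_max_image y hD
  let E := D.filter fun j => D.card ≤ 2 * (D.filter fun i => y i ≤ y j).card
  have hE : E.Nonempty := by
    refine ⟨M, Finset.mem_filter.2 ⟨hM, ?_⟩⟩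
    rw [Finset.filter_true_of_mem hMmax]
    omega
  obtain ⟨j, hj, hjmin⟩ := E.exists_min_image y hE
  obtain ⟨hjD, hj2⟩ := Finset.mem_filter.1 hj
  refine ⟨j, hjD, hj2, ?_⟩
  by_contra hlt
  have hsplit := Finset.card_filter_add_card_filter_not (s := D) fun i => y j ≤ y i
  have hne : (D.filter fun i => ¬ y j ≤ y i).Nonempty := by
    rw [← Finset.card_pos]
    omega
  obtain ⟨j', hj', hj'max⟩ := Finset.exists_max_image _ y hne
  obtain ⟨hj'D, hj'lt⟩ := Finset.mem_filter.1 hj'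
  have hsub : (D.filter fun i => ¬ y j ≤ y i).card ≤ (D.filter fun i => y i ≤ y j').card := by
    refine Finset.card_le_card fun i hi => ?_
    exact Finset.mem_filter.2 ⟨(Finset.mem_filter.1 hi).1, hj'max i hi⟩
  have hj'E : j' ∈ E := Finset.mem_filter.2 ⟨hj'D, by omega⟩
  exact hj'lt (hjmin j' hj'E)

open Classical in
/-- The cells of a balanced search tree on a finite set `V`: every point lies in few cells, and near
every point of `V` there is a node with a heavy cell such that few data points lie in between. -/
theorem exists_cells (S : ℕ) : ∀ V : Finset ℝ, V.card < 2 ^ S →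
    ∃ I : ℝ → ℝ → Prop, (∀ y, (V.filter fun z => I z y).card ≤ S) ∧
      ∀ {ι : Type} (D : Finset ι) (y : ι → ℝ) (t : ℕ), t ≤ D.card → ∀ v ∈ V,
        ∃ z ∈ V, t ≤ (D.filter fun j => I z (y j)).card ∧
          (D.filter fun j => z < y j ∧ y j ≤ v).card ≤ t ∧
          (D.filter fun j => v ≤ y j ∧ y j < z).card ≤ t := by
  induction S with
  | zero =>
    intro V hV
    have : V = ∅ := by
      rw [← Finset.card_eq_zero]
      omega
    subst this
    exact ⟨fun _ _ => False, by simp, by simp⟩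
  | succ S ih =>
    intro V hV
    rcases V.eq_empty_or_nonempty with rfl | hne
    · exact ⟨fun _ _ => False, by simp, by simp⟩
    obtain ⟨c, hc, hle, hge⟩ := exists_median V hne id
    simp only [id] at hle hge
    have hl := Finset.card_filter_add_card_filter_not (s := V) fun i => i ≤ c
    have hg := Finset.card_filter_add_card_filter_not (s := V) fun i => c ≤ i
    simp only [not_le] at hl hg
    rw [pow_succ] at hV
    obtain ⟨I₁, hI₁, hex₁⟩ := ih (V.filter fun i => i < c) (by omega)
    obtain ⟨I₂, hI₂, hex₂⟩ := ih (V.filter fun i => c < i) (by omega)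
    -- The median `c` of `V` is the root and its cell is the whole line; the cells of the two
    -- subtrees are cut off at `c`, so a point meets the root and at most one subtree.
    obtain ⟨I, hI⟩ : ∃ I : ℝ → ℝ → Prop, ∀ z y, I z y ↔
        z = c ∨ (z < c ∧ y < c ∧ I₁ z y) ∨ (c < z ∧ c < y ∧ I₂ z y) := ⟨_, fun _ _ => Iff.rfl⟩
    refine ⟨I, fun y => ?_, ?_⟩
    · rcases le_or_gt c y with hy | hy
      · have hsub : (V.filter fun z => I z y) ⊆
            insert c ((V.filter fun i => c < i).filter fun z => I₂ z y) := by
          intro z hz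
          obtain ⟨hzV, hz⟩ := Finset.mem_filter.1 hz
          rcases (hI z y).1 hz with h | h | h
          · exact Finset.mem_insert.2 (Or.inl h)
          · exact absurd h.2.1 (not_lt.2 hy)
          · exact Finset.mem_insert_of_mem
              (Finset.mem_filter.2 ⟨Finset.mem_filter.2 ⟨hzV, h.1⟩, h.2.2⟩)
        refine (Finset.card_le_card hsub).trans ((Finset.card_insert_le _ _).trans ?_)
        have := hI₂ y
        omega
      · have hsub : (V.filter fun z => I z y) ⊆
            insert c ((V.filter fun i => i < c).filter fun z => I₁ z y) := by
          intro z hz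
          obtain ⟨hzV, hz⟩ := Finset.mem_filter.1 hz
          rcases (hI z y).1 hz with h | h | h
          · exact Finset.mem_insert.2 (Or.inl h)
          · exact Finset.mem_insert_of_mem
              (Finset.mem_filter.2 ⟨Finset.mem_filter.2 ⟨hzV, h.1⟩, h.2.2⟩)
          · exact absurd h.2.1 (not_lt.2 hy.le)
        refine (Finset.card_le_card hsub).trans ((Finset.card_insert_le _ _).trans ?_)
        have := hI₁ y
        omega
    · intro ι D y t ht v hv
      have hroot : t ≤ (D.filter fun j => I c (y j)).card := by
        rwa [Finset.filter_true_of_mem fun j _ => (hI _ _).2 (Or.inl rfl)]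
      have hempty : ∀ {p : ι → Prop} [DecidablePred p], (∀ j, ¬ p j) → (D.filter p).card ≤ t := by
        intro p _ hp
        rw [Finset.filter_false_of_mem fun j _ => hp j]
        simp
      rcases lt_trichotomy v c with hvc | rfl | hvc
      -- With at least `t` data points on the side of `v`, descend. With fewer, the root serves: all
      -- data between `v` and `c` is on that side.
      · by_cases hD : t ≤ (D.filter fun j => y j < c).card
        · obtain ⟨z, hz, h1, h2, h3⟩ := hex₁ _ y t hD v (Finset.mem_filter.2 ⟨hv, hvc⟩)
          obtain ⟨hzV, hzc⟩ := Finset.mem_filter.1 hz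
          refine ⟨z, hzV, h1.trans (Finset.card_le_card fun j hj => ?_),
            (Finset.card_le_card fun j hj => ?_).trans h2,
            (Finset.card_le_card fun j hj => ?_).trans h3⟩
          · simp only [Finset.mem_filter] at hj ⊢
            exact ⟨hj.1.1, (hI _ _).2 (Or.inr (Or.inl ⟨hzc, hj.1.2, hj.2⟩))⟩
          · simp only [Finset.mem_filter] at hj ⊢
            exact ⟨⟨hj.1, hj.2.2.trans_lt hvc⟩, hj.2⟩
          · simp only [Finset.mem_filter] at hj ⊢
            exact ⟨⟨hj.1, hj.2.2.trans hzc⟩, hj.2⟩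
        · refine ⟨c, hc, hroot, hempty fun j hj => ?_,
            (Finset.card_le_card fun j hj => ?_).trans (not_le.1 hD).le⟩
          · exact (hj.1.trans_le hj.2).not_gt hvc
          · simp only [Finset.mem_filter] at hj ⊢
            exact ⟨hj.1, hj.2.2⟩
      · exact ⟨v, hc, hroot, hempty fun j hj => (hj.1.trans_le hj.2).false,
          hempty fun j hj => (hj.1.trans_lt hj.2).false⟩
      · by_cases hD : t ≤ (D.filter fun j => c < y j).card
        · obtain ⟨z, hz, h1, h2, h3⟩ := hex₂ _ y t hD v (Finset.mem_filter.2 ⟨hv, hvc⟩)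
          obtain ⟨hzV, hzc⟩ := Finset.mem_filter.1 hz
          refine ⟨z, hzV, h1.trans (Finset.card_le_card fun j hj => ?_),
            (Finset.card_le_card fun j hj => ?_).trans h2,
            (Finset.card_le_card fun j hj => ?_).trans h3⟩
          · simp only [Finset.mem_filter] at hj ⊢
            exact ⟨hj.1.1, (hI _ _).2 (Or.inr (Or.inr ⟨hzc, hj.1.2, hj.2⟩))⟩
          · simp only [Finset.mem_filter] at hj ⊢
            exact ⟨⟨hj.1, hzc.trans hj.2.1⟩, hj.2⟩
          · simp only [Finset.mem_filter] at hj ⊢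
            exact ⟨⟨hj.1, hvc.trans_le hj.2.1⟩, hj.2⟩
        · refine ⟨c, hc, hroot, (Finset.card_le_card fun j hj => ?_).trans (not_le.1 hD).le,
            hempty fun j hj => ?_⟩
          · simp only [Finset.mem_filter] at hj ⊢
            exact ⟨hj.1, hj.2.1⟩
          · exact (hj.1.trans_lt hj.2).not_gt hvc

end Cells

/-! ### Second-moment comparison of weighted distributions -/

section Weights

variable {O : Type*} [Fintype O]

/-- The distribution proportional to the nonnegative weights `w`. -/
noncomputable def ofWeights (w : O → ℝ) (hw : ∀ o, 0 ≤ w o) (hpos : 0 < ∑ o, w o) : PMF O :=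
  PMF.ofFintype (fun o => ENNReal.ofReal (w o / ∑ o, w o)) <| by
    rw [← ENNReal.ofReal_sum_of_nonneg fun o _ => div_nonneg (hw o) hpos.le, ← Finset.sum_div,
      div_self hpos.ne', ENNReal.ofReal_one]

theorem expect_ofWeights {w : O → ℝ} (hw : ∀ o, 0 ≤ w o) (hpos : 0 < ∑ o, w o) {f : O → ℝ}
    (hf : ∀ o, 0 ≤ f o) :
    expect (ofWeights w hw hpos) (fun o => ENNReal.ofReal (f o)) =
      ENNReal.ofReal (∑ o, w o / (∑ o, w o) * f o) := by
  rw [expect, tsum_fintype, ENNReal.ofReal_sum_of_nonneg fun o _ =>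
    mul_nonneg (div_nonneg (hw o) hpos.le) (hf o)]
  refine Finset.sum_congr rfl fun o _ => ?_
  rw [ENNReal.ofReal_mul (div_nonneg (hw o) hpos.le)]
  rfl

/-- If `p ≤ (1 + κ) μ` and `μ ≤ (1 + κ) p` outside of a set of small `μ`-measure, then the
second moment of the density of `p` with respect to `μ` is close to one. -/
theorem sum_mul_sq_le {p μ f : O → ℝ} {κ θ : ℝ} (hp : ∀ o, 0 ≤ p o) (hμ : ∀ o, 0 ≤ μ o)
    (hp1 : ∑ o, p o = 1) (hμ1 : ∑ o, μ o = 1) (hκ1 : κ ≤ 1)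
    (hle : ∀ o, p o ≤ (1 + κ) * μ o) (T : Finset O) (hge : ∀ o ∉ T, (1 - κ) * μ o ≤ p o)
    (hT : ∑ o ∈ T, μ o ≤ θ) :
    (∑ o, p o * f o) ^ 2 ≤ (1 + κ ^ 2 + θ) * ∑ o, μ o * f o ^ 2 := by
  classical
  have hsq : ∀ o, (p o * f o) ^ 2 = p o ^ 2 / μ o * (μ o * f o ^ 2) := by
    intro o
    rcases (hμ o).eq_or_lt with h | h
    · have := hle o
      rw [← h, mul_zero] at this
      have h0 : p o = 0 := le_antisymm this (hp o)
      simp [h0]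
    · field_simp
  -- Cauchy–Schwarz for `p·f = (p/√μ)·(√μ·f)`. Where `μ` vanishes so does `p`, and the value `p²/0 =
  -- 0` is the right one.
  refine (Finset.sum_sq_le_sum_mul_sum_of_sq_le_mul _ (fun o _ => div_nonneg (sq_nonneg _) (hμ o))
    (fun o _ => mul_nonneg (hμ o) (sq_nonneg _)) fun o _ => (hsq o).le).trans ?_
  refine mul_le_mul_of_nonneg_right ?_
    (Finset.sum_nonneg fun o _ => mul_nonneg (hμ o) (sq_nonneg _))
  -- From `p²/μ = 2p - μ + (p - μ)²/μ`: the last term is at most `κ²·μ` off `T`, and at most `μ` on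
  -- `T` because `0 ≤ p ≤ 2μ`.
  have hpt : ∀ o, p o ^ 2 / μ o ≤ 2 * p o - μ o + κ ^ 2 * μ o + if o ∈ T then μ o else 0 := by
    intro o
    rcases (hμ o).eq_or_lt with h | h
    · have := hle o
      rw [← h, mul_zero] at this
      have h0 : p o = 0 := le_antisymm this (hp o)
      simp [h0, ← h]
    · rw [div_le_iff₀ h]
      have h1 := hle o
      have h2 := hp o
      split_ifs with hoT
      · have h3 : (p o - μ o) ^ 2 ≤ μ o ^ 2 := by
          apply sq_le_sq'
          · linarith
          · nlinarith
        nlinarith [mul_nonneg (sq_nonneg κ) (sq_nonneg (μ o))]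
      · have h3 : (p o - μ o) ^ 2 ≤ (κ * μ o) ^ 2 := by
          have := hge o hoT
          apply sq_le_sq' <;> linarith
        nlinarith
  refine (Finset.sum_le_sum fun o _ => hpt o).trans ?_
  rw [Finset.sum_add_distrib, Finset.sum_add_distrib, Finset.sum_sub_distrib, ← Finset.mul_sum,
    ← Finset.mul_sum, hp1, hμ1, Finset.sum_ite_mem, Finset.univ_inter]
  linarith

/-- Comparison of two distributions given by weights `w ≤ w'`. -/
theorem expect_ofWeights_sq_le {w w' : O → ℝ} (hw : ∀ o, 0 ≤ w o) (hw' : ∀ o, 0 ≤ w' o)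
    (hpos : 0 < ∑ o, w o) (hpos' : 0 < ∑ o, w' o) (hww : ∀ o, w o ≤ w' o) {x θ : ℝ}
    (hx : 1 ≤ x) (hθ : 0 ≤ θ) (hxθ : x + θ ≤ 2) (T : Finset O)
    (hreg : ∀ o ∉ T, w' o ≤ x * w o)
    (hT : ∑ o ∈ T, w' o ≤ θ * ∑ o, w o) {f : O → ℝ≥0∞} (hf : ∀ o, f o ≤ 1) :
    expect (ofWeights w hw hpos) f ^ 2 ≤ ENNReal.ofReal (1 + (x + θ - 1) ^ 2 + θ) *
      expect (ofWeights w' hw' hpos') (fun o => f o ^ 2) := by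
  classical
  have hfr : f = fun o => ENNReal.ofReal (f o).toReal := by
    funext o
    rw [ENNReal.ofReal_toReal (ne_top_of_le_ne_top ENNReal.one_ne_top (hf o))]
  have hfr2 : (fun o => f o ^ 2) = fun o => ENNReal.ofReal ((f o).toReal ^ 2) := by
    funext o
    conv_lhs => rw [hfr]
    rw [ENNReal.ofReal_pow ENNReal.toReal_nonneg]
  rw [hfr2, expect_ofWeights _ _ fun o => sq_nonneg _]
  conv_lhs => rw [hfr]
  rw [expect_ofWeights _ _ fun o => ENNReal.toReal_nonneg,
    ← ENNReal.ofReal_mul (by positivity), ← ENNReal.ofReal_pow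
      (Finset.sum_nonneg fun o _ => mul_nonneg (div_nonneg (hw o) hpos.le) ENNReal.toReal_nonneg)]
  refine ENNReal.ofReal_le_ofReal ?_
  set Z := ∑ o, w o with hZ
  set Z' := ∑ o, w' o with hZ'
  have hZle : Z ≤ Z' := Finset.sum_le_sum fun o _ => hww o
  -- The normalizations differ by at most this factor, so the density of the first law is at most `x
  -- + θ`; off `T` it is at least `1/x ≥ 2 - x`.
  have hZ'le : Z' ≤ (x + θ) * Z := by
    have h1 : ∀ o, w' o ≤ x * w o + if o ∈ T then w' o else 0 := by
      intro o
      split_ifs with ho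
      · have := mul_nonneg (zero_le_one.trans hx) (hw o)
        linarith
      · simpa using hreg o ho
    have h2 := Finset.sum_le_sum fun o (_ : o ∈ Finset.univ) => h1 o
    rw [Finset.sum_add_distrib, ← Finset.mul_sum, Finset.sum_ite_mem, Finset.univ_inter] at h2
    rw [hZ']
    refine h2.trans ?_
    rw [add_mul]
    linarith
  have hx0 : 0 < x := by linarith
  refine sum_mul_sq_le (κ := x + θ - 1) (θ := θ) (T := T)
    (fun o => div_nonneg (hw o) hpos.le) (fun o => div_nonneg (hw' o) hpos'.le)
    (by rw [← Finset.sum_div, ← hZ, div_self hpos.ne'])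
    (by rw [← Finset.sum_div, ← hZ', div_self hpos'.ne']) (by linarith) ?_ ?_ ?_
  · intro o
    rw [add_sub_cancel, mul_div_assoc', div_le_div_iff₀ hpos hpos']
    calc w o * Z' ≤ w' o * ((x + θ) * Z) :=
          mul_le_mul (hww o) hZ'le hpos'.le (hw' o)
      _ = _ := by ring
  · intro o ho
    have h1 : (1 - (x + θ - 1)) * (w' o / Z') ≤ x⁻¹ * (w' o / Z') := by
      refine mul_le_mul_of_nonneg_right ?_ (div_nonneg (hw' o) hpos'.le)
      have h2 : 2 - x ≤ x⁻¹ := by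
        rw [← one_div, le_div_iff₀ hx0]
        nlinarith [sq_nonneg (x - 1)]
      linarith
    refine h1.trans ?_
    have h3 : x⁻¹ * w' o ≤ w o := by
      rw [inv_mul_le_iff₀ hx0]
      exact hreg o ho
    calc x⁻¹ * (w' o / Z') = x⁻¹ * w' o / Z' := by ring
      _ ≤ w o / Z' := by gcongr
      _ ≤ w o / Z := div_le_div_of_nonneg_left (hw o) hpos hZle
  · rw [← Finset.sum_div, div_le_iff₀ hpos']
    exact hT.trans (mul_le_mul_of_nonneg_left hZle hθ)

end Weights

/-! ### The private interior-point mechanism -/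

section Mechanism

variable {k : ℕ}

open Classical in
/-- The quality of `z` as an interior point of the data `y j`, `j ∈ U`: it is positive if the cell of
`z` is heavy and many data points lie on either side of `z`. All counts are increased by `t`. -/
noncomputable def quality (I : ℝ → ℝ → Prop) (κ t : ℕ) (U : Finset (Fin k)) (y : Fin k → ℝ)
    (z : ℝ) : ℕ :=
  min ((U.filter fun j => I z (y j)).card + t - κ)
    (min ((U.filter fun j => y j ≤ z).card + t - 43 * κ)
      ((U.filter fun j => z ≤ y j).card + t - 43 * κ))

/-- Deleting `J` lowers each count by at most `J.card`, and adding `J.card` back turns this into an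
overestimate. The one-sided comparison is what makes the weights below monotone. -/
theorem quality_le_quality (I : ℝ → ℝ → Prop) (κ : ℕ) (J : Finset (Fin k)) (y : Fin k → ℝ)
    (z : ℝ) :
    quality I κ 0 Finset.univ y z ≤ quality I κ J.card Jᶜ y z ∧
      quality I κ J.card Jᶜ y z ≤ quality I κ 0 Finset.univ y z + J.card := by
  classical
  have h : ∀ p : Fin k → Prop, (Finset.univ.filter p).card ≤ (Jᶜ.filter p).card + J.card ∧
      (Jᶜ.filter p).card ≤ (Finset.univ.filter p).card := by
    intro p
    refine ⟨?_, Finset.card_le_card (Finset.filter_subset_filter _ (Finset.subset_univ _))⟩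
    refine (Finset.card_le_card (t := Jᶜ.filter p ∪ J) fun j hj => ?_).trans
      (Finset.card_union_le _ _)
    by_cases hjJ : j ∈ J
    · exact Finset.mem_union_right _ hjJ
    · exact Finset.mem_union_left _
        (Finset.mem_filter.2 ⟨Finset.mem_compl.2 hjJ, (Finset.mem_filter.1 hj).2⟩)
  have h1 := h fun j => I z (y j)
  have h2 := h fun j => y j ≤ z
  have h3 := h fun j => z ≤ y j
  unfold quality
  simp only [le_min_iff, min_le_iff]
  constructor
  · omega
  · omega

/-- The weights of the possible responses: `x ^ q` for a point of quality `q > 0`, and `W` for the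
failure symbol `none`. -/
noncomputable def responseWeight (V : Finset ℝ) (x W : ℝ) (q : ℝ → ℕ) : Option V → ℝ
  | none => W
  | some z => if q z = 0 then 0 else x ^ q z

theorem responseWeight_nonneg (V : Finset ℝ) {x W : ℝ} (hx : 0 ≤ x) (hW : 0 ≤ W) (q : ℝ → ℕ)
    (o : Option V) : 0 ≤ responseWeight V x W q o := by
  rcases o with _ | z
  · exact hW
  · rw [responseWeight]
    split_ifs
    · exact le_rfl
    · exact pow_nonneg hx _

theorem le_sum_responseWeight (V : Finset ℝ) {x W : ℝ} (hx : 0 ≤ x) (hW : 0 ≤ W) (q : ℝ → ℕ) :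
    W ≤ ∑ o, responseWeight V x W q o :=
  Finset.single_le_sum (f := responseWeight V x W q)
    (fun o _ => responseWeight_nonneg V hx hW q o) (Finset.mem_univ none)

/-- The response is drawn with the given weights; the failure symbol is answered by `0`. -/
noncomputable def response (V : Finset ℝ) {x W : ℝ} (hx : 0 ≤ x) (hW : 0 < W) (q : ℝ → ℕ) :
    PMF ℝ :=
  (ofWeights (responseWeight V x W q) (responseWeight_nonneg V hx hW.le q)
    (hW.trans_le (le_sum_responseWeight V hx hW.le q))).map fun o => o.elim 0 Subtype.val

/-- A point of positive quality under both has its weight changed by a factor between `1` and `x ^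
l`. The exceptional points, with `q = 0 < q'`, number at most `H` and weigh at most `x ^ l` each,
hence are negligible against the weight `W` of the failure symbol. -/
theorem expect_response_sq_le (V : Finset ℝ) {x W θ : ℝ} (hx : 1 ≤ x) (hW : 0 < W)
    {q q' : ℝ → ℕ} {l H : ℕ} (hqq : ∀ z, q z ≤ q' z ∧ q' z ≤ q z + l)
    (hH : (V.filter fun z => q' z ≠ 0).card ≤ H) (hθ : 0 ≤ θ) (hθW : H * x ^ l ≤ θ * W)
    (hxθ : x ^ l + θ ≤ 2) {f : ℝ → ℝ≥0∞} (hf : ∀ z, f z ≤ 1) :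
    expect (response V (zero_le_one.trans hx) hW q) f ^ 2 ≤
      ENNReal.ofReal (1 + (x ^ l + θ - 1) ^ 2 + θ) *
        expect (response V (zero_le_one.trans hx) hW q') fun z => f z ^ 2 := by
  classical
  have hx0 : 0 ≤ x := zero_le_one.trans hx
  rw [response, response, expect_map, expect_map]
  refine expect_ofWeights_sq_le (w := responseWeight V x W q) (w' := responseWeight V x W q')
    (T := Finset.univ.filter fun o : Option V => ∃ z : V, o = some z ∧ q z = 0 ∧ q' z ≠ 0)
    (responseWeight_nonneg V hx0 hW.le q) (responseWeight_nonneg V hx0 hW.le q') _ _ ?_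
    (one_le_pow₀ hx) hθ hxθ ?_ ?_ fun o => hf _
  · rintro (_ | z)
    · exact le_rfl
    · have h := hqq z
      simp only [responseWeight]
      split_ifs with h1 h2 h2
      · exact le_rfl
      · positivity
      · omega
      · exact pow_le_pow_right₀ hx h.1
  · rintro (_ | z) hz
    · simp only [responseWeight]
      exact le_mul_of_one_le_left hW.le (one_le_pow₀ hx)
    · have h := hqq z
      simp only [responseWeight]
      split_ifs with h1 h2 h2
      · simp
      · positivity
      · exact absurd (Finset.mem_filter.2 ⟨Finset.mem_univ _, z, rfl, h2, h1⟩) hz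
      · rw [← pow_add]
        exact pow_le_pow_right₀ hx (by omega)
  · have hsub : (Finset.univ.filter fun o : Option V =>
        ∃ z : V, o = some z ∧ q z = 0 ∧ q' z ≠ 0).card ≤ H := by
      refine le_trans ?_ hH
      refine Finset.card_le_card_of_injOn (fun o => o.elim 0 Subtype.val) ?_ ?_
      · intro o ho
        obtain ⟨-, z, rfl, -, h2⟩ := Finset.mem_filter.1 ho
        exact Finset.mem_coe.2 (Finset.mem_filter.2 ⟨z.2, h2⟩)
      · intro o ho o' ho' hoo
        obtain ⟨-, z, rfl, -, -⟩ := Finset.mem_filter.1 ho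
        obtain ⟨-, z', rfl, -, -⟩ := Finset.mem_filter.1 ho'
        exact congrArg some (Subtype.ext hoo)
    have hone : ∀ o ∈ Finset.univ.filter fun o : Option V =>
        ∃ z : V, o = some z ∧ q z = 0 ∧ q' z ≠ 0, responseWeight V x W q' o ≤ x ^ l := by
      intro o ho
      obtain ⟨-, z, rfl, h1, h2⟩ := Finset.mem_filter.1 ho
      simp only [responseWeight, h2, if_false]
      exact pow_le_pow_right₀ hx (by have := (hqq z).2; omega)
    refine (Finset.sum_le_card_nsmul _ _ _ hone).trans ?_
    rw [nsmul_eq_mul]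
    calc _ ≤ (H : ℝ) * x ^ l := by gcongr
      _ ≤ θ * W := hθW
      _ ≤ _ := by
        gcongr
        exact le_sum_responseWeight V hx0 hW.le q

/-- Points of quality zero have weight zero, so only the failure symbol can produce such an answer;
one good point makes the total weight at least `x ^ N`. -/
theorem expect_response_quality_eq_zero (V : Finset ℝ) {x W : ℝ} (hx : 1 ≤ x) (hW : 0 < W)
    {q : ℝ → ℕ} {N : ℕ} (hN : 0 < N) (hq : ∃ z ∈ V, N ≤ q z) :
    expect (response V (zero_le_one.trans hx) hW q) ({z | q z = 0}.indicator 1) ≤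
      ENNReal.ofReal (W / x ^ N) := by
  classical
  have hx0 : 0 ≤ x := zero_le_one.trans hx
  obtain ⟨z, hz, hzN⟩ := hq
  rw [response, expect_map]
  set Z := ∑ o, responseWeight V x W q o with hZ
  have hsum : x ^ N ≤ Z := by
    have h1 := Finset.single_le_sum (f := responseWeight V x W q)
      (fun o _ => responseWeight_nonneg V hx0 hW.le q o) (Finset.mem_univ (some ⟨z, hz⟩))
    refine le_trans ?_ h1
    simp only [responseWeight]
    rw [if_neg (by omega)]
    exact pow_le_pow_right₀ hx hzN
  have hle : ∀ o : Option V,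
      ({z | q z = 0}.indicator 1 (o.elim 0 Subtype.val) : ℝ≥0∞) ≤
        ENNReal.ofReal (if o = none ∨ responseWeight V x W q o = 0 then 1 else 0) := by
    rintro (_ | z)
    · simp only [true_or, if_true, ENNReal.ofReal_one]
      exact Set.indicator_le_self' (fun _ _ => zero_le) _
    · by_cases hqz : q z = 0
      · simp [responseWeight, hqz]
      · simp [hqz]
  refine (expect_mono hle).trans ?_
  rw [expect_ofWeights _ _ fun o => by split_ifs <;> norm_num]
  refine ENNReal.ofReal_le_ofReal ?_
  rw [← hZ, Fintype.sum_option]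
  have hrest : ∑ z : V, responseWeight V x W q (some z) / Z *
      (if some z = none ∨ responseWeight V x W q (some z) = 0 then (1 : ℝ) else 0) = 0 := by
    refine Finset.sum_eq_zero fun z _ => ?_
    by_cases h : responseWeight V x W q (some z) = 0 <;> simp [h]
  rw [hrest]
  simp only [true_or, if_true, mul_one, add_zero]
  exact div_le_div_of_nonneg_left hW.le (by positivity) hsum

open Classical in
/-- A randomized response that is an interior point of the data with high probability, together with
a response that ignores the data in `J` and has almost the same law. -/
theorem exists_mechanism {S κ l : ℕ} {x W θ : ℝ} (V : Finset ℝ) (hV : V.card < 2 ^ S)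
    (hκ : 0 < κ) (hl : 2 * l ≤ κ) (hx : 1 ≤ x) (hW : 0 < W) (hθ : 0 ≤ θ)
    (hθW : 200 * S * x ^ l ≤ θ * W) (hxθ : x ^ l + θ ≤ 2) :
    ∃ (mech : (Fin (100 * κ) → ℝ) → PMF ℝ)
      (mech' : Finset (Fin (100 * κ)) → (Fin (100 * κ) → ℝ) → PMF ℝ),
      (∀ J y y', (∀ j ∉ J, y j = y' j) → mech' J y = mech' J y') ∧
      (∀ J, J.card = l → ∀ y f, (∀ z, f z ≤ 1) → expect (mech y) f ^ 2 ≤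
        ENNReal.ofReal (1 + (x ^ l + θ - 1) ^ 2 + θ) * expect (mech' J y) fun z => f z ^ 2) ∧
      ∀ y, (∀ j, y j ∈ V) →
        expect (mech y) ({z | ¬ (43 * κ < (Finset.univ.filter fun j => y j ≤ z).card ∧
          43 * κ < (Finset.univ.filter fun j => z ≤ y j).card)}.indicator 1) ≤
            ENNReal.ofReal (W / x ^ (3 * κ)) := by
  obtain ⟨I, hI, hex⟩ := exists_cells S V hV
  refine ⟨fun y => response V (zero_le_one.trans hx) hW (quality I κ 0 Finset.univ y),
    fun J y => response V (zero_le_one.trans hx) hW (quality I κ J.card Jᶜ y), ?_, ?_, ?_⟩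
  · intro J y y' hyy
    have : quality I κ J.card Jᶜ y = quality I κ J.card Jᶜ y' := by
      have hf : ∀ p : ℝ → Prop, (Jᶜ.filter fun j => p (y j)) = Jᶜ.filter fun j => p (y' j) :=
        fun p => Finset.filter_congr fun j hj => by rw [hyy j (Finset.mem_compl.1 hj)]
      funext z
      unfold quality
      rw [hf fun v => I z v, hf fun v => v ≤ z, hf fun v => z ≤ v]
    simp only [this]
  · rintro J rfl y f hf
    refine expect_response_sq_le V hx hW (H := 200 * S) (quality_le_quality I κ J y) ?_ hθ
      (by exact_mod_cast hθW) hxθ hf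
    set E := V.filter fun z => quality I κ J.card Jᶜ y z ≠ 0 with hE
    have h1 : ∀ z ∈ E, κ ≤ 2 * (Jᶜ.filter fun j => I z (y j)).card := by
      intro z hz
      have := (Finset.mem_filter.1 hz).2
      unfold quality at this
      omega
    -- Double counting of pairs (candidate, data point in its cell): a candidate of positive quality
    -- has at least `κ/2` points in its cell since `2l ≤ κ`, while each of the at most `100κ` points
    -- lies in at most `S` cells. Hence at most `200·S` candidates.
    have h2 : E.card * κ ≤ ∑ z ∈ E, 2 * (Jᶜ.filter fun j => I z (y j)).card := by
      rw [← smul_eq_mul]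
      exact Finset.card_nsmul_le_sum _ _ _ h1
    have h3 : ∑ z ∈ E, (Jᶜ.filter fun j => I z (y j)).card ≤ 100 * κ * S := by
      calc _ = ∑ j ∈ Jᶜ, (E.filter fun z => I z (y j)).card := by
            simp only [Finset.card_filter]
            exact Finset.sum_comm
        _ ≤ ∑ j ∈ Jᶜ, S := Finset.sum_le_sum fun j _ =>
            (Finset.card_le_card (Finset.filter_subset_filter _ (Finset.filter_subset _ _))).trans
              (hI (y j))
        _ ≤ _ := by
            rw [Finset.sum_const, smul_eq_mul]
            refine Nat.mul_le_mul_right _ ?_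
            simpa using Finset.card_le_univ Jᶜ
    rw [← Finset.mul_sum] at h2
    have h4 : E.card * κ ≤ 200 * S * κ := by
      calc _ ≤ _ := h2
        _ ≤ 2 * (100 * κ * S) := Nat.mul_le_mul_left _ h3
        _ = _ := by ring
    exact Nat.le_of_mul_le_mul_right h4 hκ
  · intro y hy
    have : NeZero (100 * κ) := ⟨by omega⟩
    obtain ⟨i, -, hi1, hi2⟩ := exists_median Finset.univ
      (Finset.univ_nonempty (α := Fin (100 * κ))) y
    -- The median has `50κ` points on either side, so a heavy node within `4κ` points of it keeps
    -- `46κ`. Its quality is at least `min (4κ - κ) (46κ - 43κ) = 3κ`.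
    obtain ⟨z, hz, h1, h2, h3⟩ := hex Finset.univ y (4 * κ) (by simp; omega) (y i) (hy i)
    simp only [Finset.card_univ, Fintype.card_fin] at hi1 hi2
    have hle : (Finset.univ.filter fun j => y j ≤ y i).card ≤
        (Finset.univ.filter fun j => y j ≤ z).card +
          (Finset.univ.filter fun j => z < y j ∧ y j ≤ y i).card := by
      refine (Finset.card_le_card fun j hj => ?_).trans (Finset.card_union_le _ _)
      simp only [Finset.mem_union, Finset.mem_filter, Finset.mem_univ, true_and] at hj ⊢
      rcases le_or_gt (y j) z with h | h
      · exact Or.inl h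
      · exact Or.inr ⟨h, hj⟩
    have hge : (Finset.univ.filter fun j => y i ≤ y j).card ≤
        (Finset.univ.filter fun j => z ≤ y j).card +
          (Finset.univ.filter fun j => y i ≤ y j ∧ y j < z).card := by
      refine (Finset.card_le_card fun j hj => ?_).trans (Finset.card_union_le _ _)
      simp only [Finset.mem_union, Finset.mem_filter, Finset.mem_univ, true_and] at hj ⊢
      rcases le_or_gt z (y j) with h | h
      · exact Or.inl h
      · exact Or.inr ⟨hj, h⟩
    refine le_trans (expect_mono fun v => ?_)
      (expect_response_quality_eq_zero V hx hW (N := 3 * κ) (by omega) ⟨z, hz, ?_⟩)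
    · refine Set.indicator_le_indicator_of_subset (fun v hv => ?_) (fun _ => zero_le) v
      simp only [Set.mem_ofPred_eq, quality] at hv ⊢
      omega
    · unfold quality
      omega

end Mechanism

/-! ### Transcripts and public records -/

namespace Transcript

variable {X : Type*}

theorem queries_append_some (h : Transcript X) (x : X) (z : ℝ) :
    Transcript.queries (h ++ [(x, some z)]) = h.queries + 1 := by
  simp [queries, List.countP_append]

theorem queries_append_none (h : Transcript X) (x : X) :
    Transcript.queries (h ++ [(x, none)]) = h.queries := by
  simp [queries, List.countP_append]

theorem updates_append (h : Transcript X) (p : X × Option ℝ) :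
    Transcript.updates (h ++ [p]) = h.updates ++ [p.1] := by
  simp [updates]

theorem length_updates (h : Transcript X) : h.updates.length = h.length := by
  simp [updates]

theorem queries_le_length (h : Transcript X) : h.queries ≤ h.length := List.countP_le_length

theorem AllAccurate.append {g : List X → ℝ} {α : ℝ} {h : Transcript X} (hh : h.AllAccurate g α)
    {p : X × Option ℝ} (hp : ∀ z, p.2 = some z → Accurate α (g (h.updates ++ [p.1])) z) :
    Transcript.AllAccurate g α (h ++ [p]) := by
  intro i hi z hz
  rcases Nat.lt_or_ge i h.length with hlt | hge
  · rw [List.getElem_append_left hlt] at hz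
    rw [List.take_append_of_le_length (by omega)]
    exact hh i hlt z hz
  · have hil : i = h.length := by
      simp at hi
      omega
    subst hil
    rw [List.getElem_append_right le_rfl] at hz
    simp only [Nat.sub_self, List.getElem_cons_zero] at hz
    rw [List.take_of_length_le (by simp), updates_append]
    exact hp z hz

end Transcript

/-- The public part of the play of an algorithm that works with pools of samples: the transcript and
the lengths of the stream when the preparation of the active and of the next pool began. -/
structure Record (X : Type*) where
  activeStart : ℕ
  nextStart : ℕ
  trans : Transcript X

namespace Record

variable {X : Type*}

/-- Append a round to the transcript. -/
def push (π : Record X) (p : X × Option ℝ) : Record X :=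
  ⟨π.activeStart, π.nextStart, π.trans ++ [p]⟩

/-- The next pool becomes active, and the preparation of a new pool begins. -/
def rotate (π : Record X) : Record X := ⟨π.nextStart, π.trans.length, π.trans⟩

end Record

/-! ### The idealized play with pools: change of measure and independence -/

section Pool

variable {X R : Type*} [Fintype R] {k : ℕ}

/-- The content of the active pool, of the next pool, and the public record. -/
abbrev Config (X R : Type*) (k : ℕ) := (Fin k → R) × (Fin k → R) × Record X

/-- After every `Q`-th query, the next pool becomes active and a new pool is drawn. -/
noncomputable def settle (μ : PMF R) (Q : ℕ) (c : Config X R k) : PMF (Config X R k) :=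
  if c.2.2.trans.queries % Q = 0 then
    (iid μ k).map fun ρ => (c.2.1, ρ, c.2.2.rotate)
  else PMF.pure c

/-- One round of the game, when the queries are answered from the active pool by `ans`. -/
noncomputable def poolRound (μ : PMF R) (Q : ℕ) (B : Adversary X)
    (ans : (Fin k → R) → Transcript X → X → PMF ℝ) (c : Config X R k) : PMF (Config X R k) :=
  (B c.2.2.trans).bind fun p =>
    if p.2 then
      (ans c.1 c.2.2.trans p.1).bind fun z =>
        settle μ Q (c.1, c.2.1, c.2.2.push (p.1, some z))
    else PMF.pure (c.1, c.2.1, c.2.2.push (p.1, none))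

/-- The law after a given number of rounds. -/
noncomputable def poolPlay (μ : PMF R) (Q : ℕ) (B : Adversary X)
    (ans : (Fin k → R) → Transcript X → X → PMF ℝ) : ℕ → PMF (Config X R k)
  | 0 => (iid μ k).bind fun ρ => (iid μ k).map fun ρ' => (ρ, ρ', ⟨0, 0, []⟩)
  | n + 1 => (poolPlay μ Q B ans n).bind (poolRound μ Q B ans)

variable {μ : PMF R} {Q : ℕ} {B : Adversary X}
  {ans ans' : (Fin k → R) → Transcript X → X → PMF ℝ}

theorem poolPlay_support {n : ℕ} {c : Config X R k} (hc : c ∈ (poolPlay μ Q B ans n).support) :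
    c.2.2.activeStart ≤ c.2.2.nextStart ∧ c.2.2.nextStart ≤ c.2.2.trans.length ∧
      c.2.2.trans.length = n := by
  induction n generalizing c with
  | zero =>
    simp only [poolPlay, PMF.mem_support_bind_iff, PMF.mem_support_map_iff] at hc
    obtain ⟨ρ, -, ρ', -, rfl⟩ := hc
    simp
  | succ n ih =>
    rw [poolPlay, PMF.mem_support_bind_iff] at hc
    obtain ⟨c₀, hc₀, hc⟩ := hc
    obtain ⟨h1, h2, h3⟩ := ih hc₀
    rw [poolRound, PMF.mem_support_bind_iff] at hc
    obtain ⟨p, -, hc⟩ := hc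
    split_ifs at hc
    · rw [PMF.mem_support_bind_iff] at hc
      obtain ⟨z, -, hc⟩ := hc
      rw [settle] at hc
      split_ifs at hc
      · rw [PMF.mem_support_map_iff] at hc
        obtain ⟨ρ, -, rfl⟩ := hc
        simp [Record.rotate, Record.push]
        omega
      · rw [PMF.mem_support_pure_iff] at hc
        subst hc
        simp [Record.push]
        omega
    · rw [PMF.mem_support_pure_iff] at hc
      subst hc
      simp [Record.push]
      omega

theorem expect_settle (c : Config X R k) (f : Config X R k → ℝ≥0∞) :
    expect (settle μ Q c) f = if c.2.2.trans.queries % Q = 0 then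
      expect (iid μ k) fun ρ => f (c.2.1, ρ, c.2.2.rotate) else f c := by
  rw [settle]
  split_ifs
  · rw [expect_map]
  · rw [expect_pure]

theorem expect_poolRound (c : Config X R k) (f : Config X R k → ℝ≥0∞) :
    expect (poolRound μ Q B ans c) f = expect (B c.2.2.trans) fun p =>
      if p.2 then
        expect (ans c.1 c.2.2.trans p.1) fun z =>
          expect (settle μ Q (c.1, c.2.1, c.2.2.push (p.1, some z))) f
      else f (c.1, c.2.1, c.2.2.push (p.1, none)) := by
  rw [poolRound, expect_bind]
  congr 1
  funext p
  split_ifs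
  · rw [expect_bind]
  · rw [expect_pure]

theorem expect_settle_mul_queries (c : Config X R k) (G : ℕ → ℝ≥0∞) (f : Config X R k → ℝ≥0∞) :
    expect (settle μ Q c) (fun c => G c.2.2.trans.queries * f c) =
      G c.2.2.trans.queries * expect (settle μ Q c) f := by
  rw [expect_settle, expect_settle]
  split_ifs
  · rw [← expect_const_mul]
    rfl
  · rfl

/-- The number of queries posed in epoch `e`, among the first `q` ones. -/
def epochQueries (Q e q : ℕ) : ℕ := min (q - e * Q) Q

theorem epochQueries_mono (Q e q : ℕ) : epochQueries Q e q ≤ epochQueries Q e (q + 1) := by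
  unfold epochQueries
  omega

theorem epochQueries_succ (hQ : 0 < Q) (q : ℕ) :
    epochQueries Q (q / Q) (q + 1) = epochQueries Q (q / Q) q + 1 := by
  unfold epochQueries
  have h1 := Nat.div_mul_le_self q Q
  have h2 := Nat.lt_div_mul_add (a := q) hQ
  omega

/-- If the answers in epoch `e` are replaced by answers of a similar law, the law of the whole play
remains similar, with a loss for every query in epoch `e`. -/
theorem expect_poolPlay_sq_le (hQ : 0 < Q) (e : ℕ) {a : ℝ≥0∞} (ha : 1 ≤ a)
    (hsame : ∀ ρ h x, Transcript.queries h / Q ≠ e → ans' ρ h x = ans ρ h x)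
    (hdom : ∀ ρ h x, Transcript.queries h / Q = e → ∀ f : ℝ → ℝ≥0∞, (∀ z, f z ≤ 1) →
      expect (ans ρ h x) f ^ 2 ≤ a * expect (ans' ρ h x) fun z => f z ^ 2)
    (n : ℕ) (f : Config X R k → ℝ≥0∞) (hf : ∀ c, f c ≤ 1) :
    expect (poolPlay μ Q B ans n) f ^ 2 ≤ expect (poolPlay μ Q B ans' n) fun c =>
      a ^ epochQueries Q e c.2.2.trans.queries * f c ^ 2 := by
  induction n generalizing f with
  | zero =>
    refine (expect_sq_le _ _).trans (expect_mono fun c => ?_)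
    exact le_mul_of_one_le_left' (one_le_pow₀ ha)
  | succ n ih =>
    simp only [poolPlay, expect_bind]
    refine (ih _ fun c => expect_le_one hf).trans (expect_mono fun c => ?_)
    simp only [expect_poolRound]
    -- The adversary's choice has the same law in both plays, so Jensen moves the square inside at
    -- no cost; the same holds for the drawing of a new pool.
    refine (mul_le_mul_right (expect_sq_le _ _) _).trans ?_
    rw [← expect_const_mul]
    refine expect_mono fun p => ?_
    split_ifs
    · simp only [expect_settle_mul_queries (G := fun q => a ^ epochQueries Q e q), Record.push,
        Transcript.queries_append_some, expect_const_mul]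
      have hstep : a ^ epochQueries Q e c.2.2.trans.queries *
          (expect (ans c.1 c.2.2.trans p.1) fun z =>
            expect (settle μ Q (c.1, c.2.1, c.2.2.push (p.1, some z))) f) ^ 2 ≤
          a ^ epochQueries Q e (c.2.2.trans.queries + 1) *
            expect (ans' c.1 c.2.2.trans p.1) fun z =>
              expect (settle μ Q (c.1, c.2.1, c.2.2.push (p.1, some z))) f ^ 2 := by
        by_cases he : c.2.2.trans.queries / Q = e
        · rw [← he, epochQueries_succ hQ, pow_succ a, mul_assoc]
          exact mul_le_mul_right (hdom _ _ _ he _ fun z => expect_le_one hf) _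
        · rw [hsame _ _ _ he]
          exact mul_le_mul' (pow_le_pow_right₀ ha (epochQueries_mono _ _ _)) (expect_sq_le _ _)
      refine hstep.trans (mul_le_mul_right (expect_mono fun z => expect_sq_le _ _) _)
    · simp only [Record.push, Transcript.queries_append_none]
      exact le_rfl

/-- Resample the next pool, and in epoch `e` the part `J` of the active pool. -/
noncomputable def resample (μ : PMF R) (Q e : ℕ) (J : Finset (Fin k)) (f : Config X R k → ℝ≥0∞)
    (c : Config X R k) : ℝ≥0∞ :=
  expect (iid μ k) fun ρ' => expect (iid μ k) fun ρ =>
    f (if c.2.2.trans.queries / Q = e then mix J c.1 ρ else c.1, ρ', c.2.2)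

/-- A second resampling overwrites the first, and neither touches the record that decides whether
`J` is resampled. -/
theorem resample_resample (e : ℕ) (J : Finset (Fin k)) (f : Config X R k → ℝ≥0∞)
    (c : Config X R k) :
    resample μ Q e J (resample μ Q e J f) c = resample μ Q e J f c := by
  unfold resample
  split_ifs with h
  · simp only [mix_mix, expect_const]
  · simp only [expect_const]

theorem expect_resample_fresh (e : ℕ) (J : Finset (Fin k)) (f : Config X R k → ℝ≥0∞)
    (π : Record X) :
    (expect (iid μ k) fun ρ => expect (iid μ k) fun ρ' => resample μ Q e J f (ρ, ρ', π)) =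
      expect (iid μ k) fun ρ => expect (iid μ k) fun ρ' => f (ρ, ρ', π) := by
  unfold resample
  by_cases h : π.trans.queries / Q = e
  · simp only [h, if_true, expect_const]
    rw [← expect_iid_mix μ J fun ρ => expect (iid μ k) fun ρ' => f (ρ, ρ', π)]
    refine congrArg _ (funext fun ρ => ?_)
    rw [expect_comm]
  · simp only [h, if_false, expect_const]

/-- Resampling before a round can be moved behind it: the adversary sees no pool, and no answer uses
the next pool or, in epoch `e`, the part `J`. At a rotation the resampled next pool becomes active,
so both pools are then fresh. -/
theorem resample_poolRound (e : ℕ) (J : Finset (Fin k))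
    (hindep : ∀ ρ ρ' h x, Transcript.queries h / Q = e → ans (mix J ρ ρ') h x = ans ρ h x)
    (f : Config X R k → ℝ≥0∞) (c : Config X R k) :
    resample μ Q e J (fun c => expect (poolRound μ Q B ans c) f) c =
      expect (B c.2.2.trans) fun p =>
        if p.2 then
          expect (ans c.1 c.2.2.trans p.1) fun z =>
            if (c.2.2.push (p.1, some z)).trans.queries % Q = 0 then
              expect (iid μ k) fun ρ => expect (iid μ k) fun ρ' =>
                f (ρ, ρ', (c.2.2.push (p.1, some z)).rotate)
            else resample μ Q e J f (c.1, c.2.1, c.2.2.push (p.1, some z))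
        else resample μ Q e J f (c.1, c.2.1, c.2.2.push (p.1, none)) := by
  rw [resample]
  simp only [expect_poolRound]
  have hans : ∀ ρ x, ans (if c.2.2.trans.queries / Q = e then mix J c.1 ρ else c.1)
      c.2.2.trans x = ans c.1 c.2.2.trans x := by
    intro ρ x
    split_ifs with h
    · exact hindep _ _ _ _ h
    · rfl
  simp only [hans]
  conv_lhs =>
    enter [2, ρ']
    rw [expect_comm]
  rw [expect_comm]
  refine congrArg _ (funext fun p => ?_)
  by_cases hp : p.2 = true
  · simp only [hp, if_true]
    conv_lhs =>
      enter [2, ρ']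
      rw [expect_comm]
    rw [expect_comm]
    refine congrArg _ (funext fun z => ?_)
    simp only [expect_settle]
    by_cases hrot : (c.2.2.push (p.1, some z)).trans.queries % Q = 0
    · simp only [if_pos hrot, expect_const]
    · simp only [if_neg hrot]
      rw [resample]
      -- Without a rotation the epoch is unchanged, so the same coordinates are resampled before and
      -- after the round.
      have hdiv : (c.2.2.push (p.1, some z)).trans.queries / Q = c.2.2.trans.queries / Q := by
        simp only [Record.push, Transcript.queries_append_some] at hrot ⊢
        rw [Nat.succ_div, if_neg (fun hd => hrot (Nat.mod_eq_zero_of_dvd hd)), add_zero]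
      simp only [hdiv]
  · simp only [if_neg hp]
    rw [resample]
    simp only [Record.push, Transcript.queries_append_none]

/-- If the answers in epoch `e` do not depend on the part `J` of the active pool, then this part is
independent of the transcript as long as epoch `e` lasts. -/
theorem expect_poolPlay_resample (e : ℕ) (J : Finset (Fin k))
    (hindep : ∀ ρ ρ' h x, Transcript.queries h / Q = e → ans (mix J ρ ρ') h x = ans ρ h x)
    (n : ℕ) (f : Config X R k → ℝ≥0∞) :
    expect (poolPlay μ Q B ans n) (resample μ Q e J f) = expect (poolPlay μ Q B ans n) f := by
  induction n generalizing f with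
  | zero =>
    simp only [poolPlay, expect_bind, expect_map]
    exact expect_resample_fresh e J f _
  | succ n ih =>
    simp only [poolPlay, expect_bind]
    -- The induction hypothesis inserts a resampling before the last round on both sides; pushed
    -- through the round, it makes the additional one at the end redundant.
    rw [← ih fun c => expect (poolRound μ Q B ans c) f,
      ← ih fun c => expect (poolRound μ Q B ans c) (resample μ Q e J f)]
    refine congrArg _ (funext fun c => ?_)
    simp only [resample_poolRound e J hindep, resample_resample, expect_resample_fresh]

end Pool

/-! ### Generalization: few bad samples, hence accurate responses -/

section Generalization

variable {X R : Type*} [Fintype R] {k : ℕ} {μ : PMF R} {Q : ℕ} {B : Adversary X}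

/-- The responses obtained by applying `mech` to the outputs of the samples in the active pool. -/
noncomputable def poolAnswer (mech : (Fin k → ℝ) → PMF ℝ) (val : R → List X → ℝ) (ρ : Fin k → R)
    (h : Transcript X) (x : X) : PMF ℝ :=
  mech fun j => val (ρ j) (h.updates ++ [x])

open Classical in
-- Pass to the play in which the answers of epoch `e` ignore `J`: this costs `a` per query of the
-- epoch. There the samples in `J` are fresh even given the next update, so they are simultaneously
-- bad with probability at most `δ ^ J.card`.
theorem expect_forall_bad_sq_le {mech : (Fin k → ℝ) → PMF ℝ} {mech' : (Fin k → ℝ) → PMF ℝ}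
    (val : R → List X → ℝ) (hQ : 0 < Q) {J : Finset (Fin k)} {a δ : ℝ≥0∞} (ha : 1 ≤ a)
    (hindep : ∀ y y', (∀ j ∉ J, y j = y' j) → mech' y = mech' y')
    (hdom : ∀ y f, (∀ z, f z ≤ 1) →
      expect (mech y) f ^ 2 ≤ a * expect (mech' y) fun z => f z ^ 2)
    (bad : R → List X → Prop)
    (hbad : ∀ x, x ≠ [] → expect μ ({r | bad r x}.indicator 1) ≤ δ) (e n : ℕ) :
    (expect (poolPlay μ Q B (poolAnswer mech val) n) fun c =>
      if c.2.2.trans.queries / Q = e then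
        expect (B c.2.2.trans) fun p =>
          ∏ j ∈ J, {r | bad r (c.2.2.trans.updates ++ [p.1])}.indicator 1 (c.1 j)
      else 0) ^ 2 ≤ a ^ Q * δ ^ J.card := by
  let ans' : (Fin k → R) → Transcript X → X → PMF ℝ := fun ρ h x =>
    if h.queries / Q = e then poolAnswer mech' val ρ h x else poolAnswer mech val ρ h x
  set f : Config X R k → ℝ≥0∞ := fun c =>
    if c.2.2.trans.queries / Q = e then
      expect (B c.2.2.trans) fun p =>
        ∏ j ∈ J, {r | bad r (c.2.2.trans.updates ++ [p.1])}.indicator 1 (c.1 j)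
    else 0 with hfdef
  have hf : ∀ c, f c ≤ 1 := by
    intro c
    simp only [hfdef]
    split_ifs
    · refine expect_le_one fun p => Finset.prod_le_one' fun j _ => ?_
      exact Set.indicator_le_self' (fun _ _ => zero_le) _
    · exact zero_le
  have h1 := expect_poolPlay_sq_le (μ := μ) (B := B) (ans := poolAnswer mech val) (ans' := ans')
    hQ e ha (fun ρ h x he => if_neg he) (fun ρ h x he f hf => by
      simp only [ans', if_pos he]
      exact hdom _ f hf) n f hf
  refine h1.trans ?_
  have h2 : (expect (poolPlay μ Q B ans' n) fun c =>
      a ^ epochQueries Q e c.2.2.trans.queries * f c ^ 2) ≤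
      a ^ Q * expect (poolPlay μ Q B ans' n) f := by
    rw [← expect_const_mul]
    -- An epoch has at most `Q` queries, and `f ^ 2 ≤ f` because `f ≤ 1`.
    refine expect_mono fun c => mul_le_mul' (pow_le_pow_right₀ ha (min_le_right _ _)) ?_
    rw [sq]
    exact mul_le_of_le_one_left' (hf c)
  refine h2.trans (mul_le_mul_right ?_ _)
  rw [← expect_poolPlay_resample e J]
  · refine (expect_mono (g := fun _ => δ ^ J.card) fun c => ?_).trans (expect_const _ _).le
    simp only [resample, hfdef]
    by_cases he : c.2.2.trans.queries / Q = e
    · simp only [if_pos he, expect_const]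
      rw [expect_comm]
      refine (expect_mono (g := fun _ => δ ^ J.card) fun p => ?_).trans (expect_const _ _).le
      have h3 : ∀ ρ : Fin k → R,
          (∏ j ∈ J, {r | bad r (c.2.2.trans.updates ++ [p.1])}.indicator (1 : R → ℝ≥0∞)
            (mix J c.1 ρ j)) =
          ∏ j ∈ J, {r | bad r (c.2.2.trans.updates ++ [p.1])}.indicator 1 (ρ j) := by
        intro ρ
        refine Finset.prod_congr rfl fun j hj => ?_
        simp only [mix, if_pos hj]
      simp only [h3]
      rw [expect_iid_prod]
      exact pow_le_pow_left' (hbad _ (by simp)) _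
    · simp only [if_neg he, expect_const]
      exact zero_le
  · intro ρ ρ' h x he
    simp only [ans', if_pos he, poolAnswer]
    refine hindep _ _ fun j hj => ?_
    simp only [mix, if_neg hj]

open Classical in
-- The right side counts the `l`-subsets contained in `P`. Taking expectations bounds the
-- probability of more than `N` successes, as in Markov's inequality for a factorial moment.
theorem indicator_mul_choose_le {N l : ℕ} (P : Fin k → Prop) :
    (if N < (Finset.univ.filter P).card then (1 : ℝ≥0∞) else 0) * N.choose l ≤
      ∑ J ∈ Finset.powersetCard l Finset.univ, ∏ j ∈ J, if P j then 1 else 0 := by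
  split_ifs with h
  · rw [one_mul]
    calc (N.choose l : ℝ≥0∞) ≤ ((Finset.powersetCard l (Finset.univ.filter P)).card : ℝ≥0∞) := by
          rw [Finset.card_powersetCard]
          exact_mod_cast Nat.choose_le_choose l h.le
      _ = ∑ J ∈ Finset.powersetCard l (Finset.univ.filter P), ∏ j ∈ J, if P j then 1 else 0 := by
          rw [Finset.card_eq_sum_ones, Nat.cast_sum]
          refine Finset.sum_congr rfl fun J hJ => ?_
          rw [Finset.prod_eq_one, Nat.cast_one]
          intro j hj
          rw [if_pos (Finset.mem_filter.1 ((Finset.mem_powersetCard.1 hJ).1 hj)).2]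
      _ ≤ _ := Finset.sum_le_sum_of_subset
          (Finset.powersetCard_mono (Finset.filter_subset _ _))
  · rw [zero_mul]
    exact zero_le

open Classical in
/-- With high probability, few samples in the active pool are bad for the stream chosen by the
adversary. -/
theorem expect_many_bad_le {mech : (Fin k → ℝ) → PMF ℝ}
    {mech' : Finset (Fin k) → (Fin k → ℝ) → PMF ℝ}
    (val : R → List X → ℝ) (hQ : 0 < Q) {l N : ℕ} {a δ b D : ℝ≥0∞} (ha : 1 ≤ a)
    (hindep : ∀ J y y', (∀ j ∉ J, y j = y' j) → mech' J y = mech' J y')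
    (hdom : ∀ J, J.card = l → ∀ y f, (∀ z, f z ≤ 1) →
      expect (mech y) f ^ 2 ≤ a * expect (mech' J y) fun z => f z ^ 2)
    (bad : R → List X → Prop)
    (hbad : ∀ x, x ≠ [] → expect μ ({r | bad r x}.indicator 1) ≤ δ)
    (hlN : l ≤ N) (hb : a ^ Q * δ ^ l ≤ b ^ 2) (hD : k.choose l * b ≤ D * N.choose l) (n : ℕ) :
    (expect (poolPlay μ Q B (poolAnswer mech val) n) fun c =>
      expect (B c.2.2.trans) fun p =>
        if N < (Finset.univ.filter fun j => bad (c.1 j) (c.2.2.trans.updates ++ [p.1])).card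
          then 1 else 0) ≤ (n + 1) * D := by
  set P := poolPlay μ Q B (poolAnswer mech val) n
  set F : Config X R k → ℝ≥0∞ := fun c => expect (B c.2.2.trans) fun p =>
        if N < (Finset.univ.filter fun j => bad (c.1 j) (c.2.2.trans.updates ++ [p.1])).card
          then 1 else 0 with hF
  -- After `n` rounds the epoch index is at most `n`; this crude union bound over epochs only costs
  -- a factor that `l` absorbs.
  have hsplit : expect P F = ∑ e ∈ Finset.range (n + 1), expect P fun c =>
      if c.2.2.trans.queries / Q = e then F c else 0 := by
    rw [← expect_finset_sum]
    refine expect_congr_support fun c hc => ?_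
    rw [Finset.sum_ite_eq, if_pos]
    obtain ⟨-, -, h3⟩ := poolPlay_support hc
    have h4 := Transcript.queries_le_length c.2.2.trans
    have h5 := Nat.div_le_self c.2.2.trans.queries Q
    rw [Finset.mem_range]
    omega
  have hone : ∀ e, (expect P fun c => if c.2.2.trans.queries / Q = e then F c else 0) ≤ D := by
    intro e
    have hpos : (N.choose l : ℝ≥0∞) ≠ 0 := by
      exact_mod_cast (Nat.choose_pos hlN).ne'
    refine (ENNReal.mul_le_mul_iff_left hpos (ENNReal.natCast_ne_top _)).1 (le_trans ?_ hD)
    have hJ : ∀ J ∈ Finset.powersetCard l (Finset.univ : Finset (Fin k)),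
        (expect P fun c => if c.2.2.trans.queries / Q = e then
          expect (B c.2.2.trans) fun p =>
            ∏ j ∈ J, {r | bad r (c.2.2.trans.updates ++ [p.1])}.indicator 1 (c.1 j)
          else 0) ≤ b := by
      intro J hJ
      have hJl := (Finset.mem_powersetCard.1 hJ).2
      have h := expect_forall_bad_sq_le (B := B) (mech := mech) val hQ ha (hindep J) (hdom J hJl)
        bad hbad e n
      rw [hJl] at h
      exact (ENNReal.pow_le_pow_left_iff two_ne_zero).1 (h.trans hb)
    calc _ = expect P fun c => (N.choose l : ℝ≥0∞) *
            (if c.2.2.trans.queries / Q = e then F c else 0) := by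
          rw [expect_const_mul, mul_comm]
      _ ≤ expect P fun c => ∑ J ∈ Finset.powersetCard l (Finset.univ : Finset (Fin k)),
            if c.2.2.trans.queries / Q = e then
              expect (B c.2.2.trans) fun p =>
                ∏ j ∈ J, {r | bad r (c.2.2.trans.updates ++ [p.1])}.indicator 1 (c.1 j)
            else 0 := by
          refine expect_mono fun c => ?_
          by_cases he : c.2.2.trans.queries / Q = e
          · simp only [if_pos he, hF]
            rw [← expect_const_mul, ← expect_finset_sum]
            refine expect_mono fun p => ?_
            rw [mul_comm]
            refine (indicator_mul_choose_le _).trans (le_of_eq ?_)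
            refine Finset.sum_congr rfl fun J _ => Finset.prod_congr rfl fun j _ => ?_
            simp [Set.indicator_apply]
          · simp only [if_neg he, mul_zero]
            exact zero_le
      _ ≤ ∑ J ∈ Finset.powersetCard l (Finset.univ : Finset (Fin k)), b := by
          rw [expect_finset_sum]
          exact Finset.sum_le_sum hJ
      _ = _ := by
          rw [Finset.sum_const, Finset.card_powersetCard, Finset.card_univ, Fintype.card_fin,
            nsmul_eq_mul]
  rw [hsplit]
  refine (Finset.sum_le_sum fun e _ => hone e).trans (le_of_eq ?_)
  rw [Finset.sum_const, Finset.card_range, nsmul_eq_mul]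
  push_cast
  rfl

theorem Accurate.of_le_of_le {α y z₁ z₂ z : ℝ} (h₁ : Accurate α y z₁) (h₂ : Accurate α y z₂)
    (hz₁ : z₁ ≤ z) (hz₂ : z ≤ z₂) : Accurate α y z := by
  unfold Accurate at *
  rw [abs_le] at *
  constructor <;> linarith [h₁.1, h₂.2]

open Classical in
/-- An interior point of the outputs is accurate if few of them are inaccurate. -/
theorem accurate_of_interior {N : ℕ} {α v z : ℝ} (y : Fin k → ℝ)
    (hbad : (Finset.univ.filter fun j => ¬ Accurate α v (y j)).card ≤ N)
    (h₁ : N < (Finset.univ.filter fun j => y j ≤ z).card)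
    (h₂ : N < (Finset.univ.filter fun j => z ≤ y j).card) : Accurate α v z := by
  obtain ⟨i, hi, hi'⟩ := Finset.exists_mem_notMem_of_card_lt_card (hbad.trans_lt h₁)
  obtain ⟨j, hj, hj'⟩ := Finset.exists_mem_notMem_of_card_lt_card (hbad.trans_lt h₂)
  simp only [Finset.mem_filter, Finset.mem_univ, true_and, not_not] at hi hi' hj hj'
  exact hi'.of_le_of_le hj' hi hj

open Classical in
/-- The probability that some response is inaccurate. -/
theorem expect_inaccurate_le {mech : (Fin k → ℝ) → PMF ℝ}
    {mech' : Finset (Fin k) → (Fin k → ℝ) → PMF ℝ} {V : Finset ℝ} {g : List X → ℝ} {α : ℝ} {m : ℕ}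
    {val : R → List X → ℝ} (hval : ∀ r x, val r x ∈ V) (hQ : 0 < Q) {l N : ℕ}
    {a δ b D τ : ℝ≥0∞} (ha : 1 ≤ a)
    (hindep : ∀ J y y', (∀ j ∉ J, y j = y' j) → mech' J y = mech' J y')
    (hdom : ∀ J, J.card = l → ∀ y f, (∀ z, f z ≤ 1) →
      expect (mech y) f ^ 2 ≤ a * expect (mech' J y) fun z => f z ^ 2)
    (hutil : ∀ y, (∀ j, y j ∈ V) →
        expect (mech y) ({z | ¬ (N < (Finset.univ.filter fun j => y j ≤ z).card ∧
          N < (Finset.univ.filter fun j => z ≤ y j).card)}.indicator 1) ≤ τ)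
    (hbad : ∀ x, x ≠ [] → x.length ≤ m →
      expect μ ({r | ¬ Accurate α (g x) (val r x)}.indicator 1) ≤ δ)
    (hlN : l ≤ N) (hb : a ^ Q * δ ^ l ≤ b ^ 2) (hD : k.choose l * b ≤ D * N.choose l) (n : ℕ) :
    (expect (poolPlay μ Q B (poolAnswer mech val) n) fun c =>
      if c.2.2.trans.length ≤ m ∧ ¬ c.2.2.trans.AllAccurate g α then 1 else 0) ≤
        n * ((n + 1) * D + τ) := by
  -- The guarantee of the oblivious algorithm covers streams of length at most `m` only; building
  -- the length into `bad` makes its probability small for every nonempty stream.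
  obtain ⟨bad, hbad_iff⟩ : ∃ bad : R → List X → Prop,
      ∀ r x, bad r x ↔ x.length ≤ m ∧ ¬ Accurate α (g x) (val r x) := ⟨_, fun _ _ => Iff.rfl⟩
  have hbad' : ∀ x, x ≠ [] → expect μ ({r | bad r x}.indicator 1) ≤ δ := by
    intro x hx
    by_cases hxm : x.length ≤ m
    · refine (expect_mono fun r => ?_).trans (hbad x hx hxm)
      exact Set.indicator_le_indicator_of_subset (fun r hr => ((hbad_iff r x).1 hr).2)
        (fun _ => zero_le) r
    · refine (expect_mono (g := fun _ => 0) fun r => ?_).trans ?_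
      · rw [Set.indicator_of_notMem]
        exact fun hr => hxm ((hbad_iff r x).1 hr).1
      · rw [expect_const]
        exact zero_le
  induction n with
  | zero =>
    have hnil : Transcript.AllAccurate g α ([] : Transcript X) := fun i hi => by simp at hi
    simp [poolPlay, expect_bind, expect_map, hnil, expect_const]
  | succ n ih =>
    have hmany := expect_many_bad_le (B := B) (mech := mech) val hQ ha hindep hdom bad hbad' hlN
      hb hD n
    rw [poolPlay, expect_bind]
    have hround : ∀ c : Config X R k,
        (expect (poolRound μ Q B (poolAnswer mech val) c) fun c =>
          if c.2.2.trans.length ≤ m ∧ ¬ c.2.2.trans.AllAccurate g α then 1 else 0) ≤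
        (if c.2.2.trans.length ≤ m ∧ ¬ c.2.2.trans.AllAccurate g α then 1 else 0) +
          ((expect (B c.2.2.trans) fun p => if N < (Finset.univ.filter fun j =>
            bad (c.1 j) (c.2.2.trans.updates ++ [p.1])).card then 1 else 0) + τ) := by
      intro c
      by_cases hc : c.2.2.trans.length ≤ m ∧ ¬ c.2.2.trans.AllAccurate g α
      · rw [if_pos hc]
        refine (expect_le_one fun c => ?_).trans le_self_add
        split_ifs <;> simp
      rw [if_neg hc, zero_add]
      by_cases hlen : c.2.2.trans.length + 1 ≤ m
      swap
      · refine (expect_congr_support (g := fun _ => 0) ?_).le.trans ?_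
        · intro c' hc'
          rw [if_neg]
          rintro ⟨h, -⟩
          rw [poolRound, PMF.mem_support_bind_iff] at hc'
          obtain ⟨p, -, hc'⟩ := hc'
          split_ifs at hc'
          · rw [PMF.mem_support_bind_iff] at hc'
            obtain ⟨z, -, hc'⟩ := hc'
            rw [settle] at hc'
            split_ifs at hc'
            · rw [PMF.mem_support_map_iff] at hc'
              obtain ⟨ρ, -, rfl⟩ := hc'
              simp [Record.rotate, Record.push] at h
              omega
            · rw [PMF.mem_support_pure_iff] at hc'
              subst hc'
              simp [Record.push] at h
              omega
          · rw [PMF.mem_support_pure_iff] at hc'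
            subst hc'
            simp [Record.push] at h
            omega
        · rw [expect_const]
          exact zero_le
      have hacc : c.2.2.trans.AllAccurate g α := by
        by_contra h
        exact hc ⟨by omega, h⟩
      rw [expect_poolRound]
      have hτ : expect (B c.2.2.trans) (fun _ => τ) = τ := expect_const _ _
      rw [← hτ, ← expect_add]
      refine expect_mono fun p => ?_
      by_cases hp : p.2 = true
      · rw [if_pos hp]
        -- A first inaccurate response has one of two causes: too many bad samples, or a response of
        -- `mech` that is not an interior point.
        by_cases hN : N < (Finset.univ.filter fun j =>
            bad (c.1 j) (c.2.2.trans.updates ++ [p.1])).card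
        · rw [if_pos hN]
          refine (expect_le_one fun z => expect_le_one fun c => ?_).trans le_self_add
          split_ifs <;> simp
        · rw [if_neg hN, zero_add]
          refine le_trans (expect_mono fun z => ?_)
            (hutil (fun j => val (c.1 j) (c.2.2.trans.updates ++ [p.1])) fun j => hval _ _)
          have hset : expect (settle μ Q (c.1, c.2.1, c.2.2.push (p.1, some z))) (fun c =>
              if c.2.2.trans.length ≤ m ∧ ¬ c.2.2.trans.AllAccurate g α then (1 : ℝ≥0∞) else 0) =
              if (c.2.2.trans ++ [(p.1, some z)]).length ≤ m ∧
                ¬ Transcript.AllAccurate g α (c.2.2.trans ++ [(p.1, some z)]) then 1 else 0 := by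
            rw [expect_settle]
            split_ifs <;> simp_all [Record.push, Record.rotate, expect_const]
          rw [hset]
          split_ifs with h
          · rw [Set.indicator_of_mem]
            · exact le_rfl
            · rintro ⟨h1, h2⟩
              refine h.2 (hacc.append fun z' hz' => ?_)
              obtain rfl : z = z' := by simpa using hz'
              refine accurate_of_interior (N := N)
                (fun j => val (c.1 j) (c.2.2.trans.updates ++ [p.1])) ?_ h1 h2
              refine le_trans (Finset.card_le_card fun j hj => ?_) (not_lt.1 hN)
              refine Finset.mem_filter.2 ⟨Finset.mem_univ _,
                (hbad_iff _ _).2 ⟨?_, (Finset.mem_filter.1 hj).2⟩⟩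
              simp [Transcript.length_updates]
              omega
          · exact zero_le
      · rw [if_neg hp, if_neg]
        · exact zero_le
        · rintro ⟨-, h⟩
          exact h (hacc.append fun z hz => by simp at hz)
    refine (expect_mono hround).trans ?_
    rw [expect_add, expect_add, expect_const]
    refine (add_le_add ih (add_le_add hmany le_rfl)).trans ?_
    push_cast
    rw [add_one_mul (n : ℝ≥0∞) (((n : ℝ≥0∞) + 1 + 1) * D + τ)]
    have h1 : ((n : ℝ≥0∞) + 1) * D + τ ≤ (n + 1 + 1) * D + τ :=
      add_le_add (mul_le_mul_left le_self_add _) le_rfl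
    exact add_le_add (mul_le_mul_right h1 _) h1

end Generalization

/-! ### The concrete algorithm with advice -/

section Simulation

variable {X : Type*} (A : SegmentedAlgorithm X)

/-- The stream `x` with a query in every round. -/
def queried (x : List X) : List (X × Bool) := x.map fun a => (a, true)

theorem queried_append (x y : List X) : queried (x ++ y) = queried x ++ queried y :=
  List.map_append

theorem SegmentedAlgorithm.run_append_singleton (r : A.SR) (u : List (X × Bool))
    (p : X × Bool) : A.run r (u ++ [p]) = A.update r (A.run r u) p := by
  simp [SegmentedAlgorithm.run]

/-- The memory of the robust algorithm: the samples of the active pool with the state reached on a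
prefix and on the remaining part of the stream; the samples of the next pool with the state reached
on the second part; the advice bits collected; the length of the prefix for the next pool, the
length of the stream, and the number of advice bits. -/
abbrev PoolState (k b m : ℕ) : Type :=
  (Fin k → A.SR × A.SV × A.SV × A.SC) × (Fin k → A.SR × A.SV × A.SC) × (Fin (k * b) → Bool) ×
    Fin (m + 1) × Fin (m + 1) × Fin (k * b + 1)

variable {k b : ℕ} (m : ℕ) (enc : A.SV → Fin b → Bool)

/-- The memory content after the stream `x`, when `t` advice bits have been collected. -/
def snapshot (ρ ρ' : Fin k → A.SR) (i i' : ℕ) (x : List X) (t : ℕ) : PoolState A k b m :=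
  (fun j => (ρ j, (A.run (ρ j) (queried (x.take i))).1, A.run (ρ j) (queried (x.drop i))),
    fun j => (ρ' j, A.run (ρ' j) (queried (x.drop i'))),
    fun n => if n.val < t then
        enc (A.run (ρ' (finProdFinEquiv.symm n).1) (queried (x.take i'))).1
          (finProdFinEquiv.symm n).2
      else false,
    Fin.ofNat _ i', Fin.ofNat _ x.length, Fin.ofNat _ t)

/-- The robust algorithm: responses are computed by `mech` from the active pool, while the state
vectors of the next pool are requested bit by bit. -/
noncomputable def poolAlgorithm (mech : (Fin k → ℝ) → PMF ℝ) (dec : (Fin b → Bool) → A.SV) :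
    ASAAlgorithm X where
  State := PoolState A k b m
  init := (iid A.coins k).bind fun ρ => (iid A.coins k).map fun ρ' =>
    snapshot A m enc ρ ρ' 0 0 [] 0
  -- The copies are always fed the query demand `true`, since the oblivious guarantee concerns
  -- streams queried in every round.
  update σ x := PMF.pure
    (fun j => ((σ.1 j).1, (σ.1 j).2.1, A.update (σ.1 j).1 (σ.1 j).2.2 (x, true)),
      fun j => ((σ.2.1 j).1, A.update (σ.2.1 j).1 (σ.2.1 j).2 (x, true)),
      σ.2.2.1, σ.2.2.2.1, Fin.ofNat _ (σ.2.2.2.2.1.val + 1), σ.2.2.2.2.2)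
  answer σ := (mech fun j =>
    A.respond (σ.1 j).1 (A.vec (σ.1 j).2.1 + A.vec (σ.1 j).2.2.1)).map fun z => (z, σ)
  -- The requested bit concerns a fixed prefix, whose length is stored, so it does not matter that
  -- the stream grows while the bits arrive.
  predicate σ x :=
    if h : σ.2.2.2.2.2.val < k * b then
      enc (A.run (σ.2.1 (finProdFinEquiv.symm ⟨_, h⟩).1).1
        (queried (x.take σ.2.2.2.1.val))).1 (finProdFinEquiv.symm ⟨_, h⟩).2
    else false
  receive σ a :=
    if σ.2.2.2.2.2.val + 1 = k * b then
      (iid A.coins k).map fun ρ =>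
        (fun j => ((σ.2.1 j).1,
            dec fun i => if (finProdFinEquiv (j, i)).val = σ.2.2.2.2.2.val then a
              else σ.2.2.1 (finProdFinEquiv (j, i)), (σ.2.1 j).2),
          fun j => (ρ j, A.initV (ρ j), A.initC (ρ j)),
          fun _ => false, σ.2.2.2.2.1, σ.2.2.2.2.1, 0)
    else PMF.pure (σ.1, σ.2.1,
      fun n => if n.val = σ.2.2.2.2.2.val then a else σ.2.2.1 n,
      σ.2.2.2.1, σ.2.2.2.2.1, Fin.ofNat _ (σ.2.2.2.2.2.val + 1))

variable {m enc} {mech : (Fin k → ℝ) → PMF ℝ} {dec : (Fin b → Bool) → A.SV}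

theorem poolAlgorithm_update (ρ ρ' : Fin k → A.SR) {i i' : ℕ} {x : List X} (t : ℕ)
    (hi : i ≤ x.length) (hi' : i' ≤ x.length) (a : X) :
    (poolAlgorithm A m enc mech dec).update (snapshot A m enc ρ ρ' i i' x t) a =
      PMF.pure (snapshot A m enc ρ ρ' i i' (x ++ [a]) t) := by
  simp only [poolAlgorithm, snapshot]
  rw [List.take_append_of_le_length hi, List.take_append_of_le_length hi',
    List.drop_append_of_le_length hi, List.drop_append_of_le_length hi']
  simp only [queried_append]
  simp only [queried, List.map_cons, List.map_nil, A.run_append_singleton, List.length_append,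
    List.length_cons, List.length_nil, zero_add]
  congr 6
  ext
  simp

/-- Linearity glues the vector on the prefix, known through advice, to the vector on the suffix,
computed online. The work space on the prefix is not needed, as responses depend only on the random
segment and the vector. -/
theorem poolAlgorithm_answer (hA : A.IsLinearState m) (ρ ρ' : Fin k → A.SR) {i i' : ℕ}
    {x : List X} (t : ℕ) (hx : x.length ≤ m) :
    (poolAlgorithm A m enc mech dec).answer (snapshot A m enc ρ ρ' i i' x t) =
      (mech fun j => A.output (ρ j) x).map fun z => (z, snapshot A m enc ρ ρ' i i' x t) := by
  have h : ∀ j, A.respond (ρ j) (A.vec (A.run (ρ j) (queried (x.take i))).1 +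
      A.vec (A.run (ρ j) (queried (x.drop i))).1) = A.output (ρ j) x := by
    intro j
    have h1 := hA (ρ j) (queried (x.take i)) (queried (x.drop i)) (by
      simp only [queried, List.length_map, ← List.length_append, List.take_append_drop]
      exact hx)
    rw [← queried_append, List.take_append_drop] at h1
    unfold SegmentedAlgorithm.output
    rw [show (x.map fun a => (a, true)) = queried x from rfl, h1]
    rfl
  simp only [poolAlgorithm, snapshot, h]

/-- The last bit of an epoch completes the encodings of all prefix vectors of the next pool. This
pool becomes active, and a fresh one starts from the empty suffix at the current position. -/
theorem poolAlgorithm_receive (hdec : ∀ v, dec (enc v) = v) (ρ ρ' : Fin k → A.SR) {i i' : ℕ}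
    {x : List X} {t : ℕ} (ht : t < k * b) (hi' : i' ≤ m) :
    (poolAlgorithm A m enc mech dec).receive (snapshot A m enc ρ ρ' i i' x t)
      ((poolAlgorithm A m enc mech dec).predicate (snapshot A m enc ρ ρ' i i' x t) x) =
    if t + 1 = k * b then
      (iid A.coins k).map fun ρ'' => snapshot A m enc ρ' ρ'' i' x.length x 0
    else PMF.pure (snapshot A m enc ρ ρ' i i' x (t + 1)) := by
  have htv : (Fin.ofNat (k * b + 1) t).val = t := by
    rw [Fin.val_ofNat, Nat.mod_eq_of_lt (by omega)]
  have hiv : (Fin.ofNat (m + 1) i').val = i' := by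
    rw [Fin.val_ofNat, Nat.mod_eq_of_lt (by omega)]
  have hbit : ∀ n : Fin (k * b), n.val < t + 1 →
      (if n.val = t then
        enc (A.run (ρ' (finProdFinEquiv.symm ⟨t, ht⟩).1) (queried (x.take i'))).1
          (finProdFinEquiv.symm ⟨t, ht⟩).2
        else if n.val < t then
          enc (A.run (ρ' (finProdFinEquiv.symm n).1) (queried (x.take i'))).1
            (finProdFinEquiv.symm n).2 else false) =
      enc (A.run (ρ' (finProdFinEquiv.symm n).1) (queried (x.take i'))).1
        (finProdFinEquiv.symm n).2 := by
    intro n hn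
    split_ifs with h1 h2
    · obtain rfl : n = ⟨t, ht⟩ := Fin.ext h1
      rfl
    · rfl
    · omega
  simp only [poolAlgorithm, snapshot, htv, hiv, ht, dif_pos]
  split_ifs with hT
  · congr 1
    funext ρ''
    have hd : ∀ j, dec (fun l => if (finProdFinEquiv (j, l) : Fin (k * b)).val = t then
        enc (A.run (ρ' (finProdFinEquiv.symm ⟨t, ht⟩).1) (queried (x.take i'))).1
          (finProdFinEquiv.symm ⟨t, ht⟩).2
        else if (finProdFinEquiv (j, l) : Fin (k * b)).val < t then
          enc (A.run (ρ' (finProdFinEquiv.symm (finProdFinEquiv (j, l))).1)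
            (queried (x.take i'))).1 (finProdFinEquiv.symm (finProdFinEquiv (j, l))).2
          else false) = (A.run (ρ' j) (queried (x.take i'))).1 := by
      intro j
      rw [← hdec (A.run (ρ' j) (queried (x.take i'))).1]
      congr 1
      funext l
      rw [hbit _ (by rw [hT]; exact (finProdFinEquiv (j, l)).isLt)]
      simp
    simp only [hd]
    simp [queried, SegmentedAlgorithm.run]
  · congr 4
    funext n
    by_cases hn : n.val < t + 1
    · rw [hbit n hn, if_pos hn]
    · rw [if_neg hn, if_neg (by omega), if_neg (by omega)]

end Simulation

/-! ### The concrete play is an image of the idealized play -/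

section Refinement

variable {X R : Type*} [Fintype R] {k : ℕ} {A : ASAAlgorithm X} {μ : PMF R}
  {mech : (Fin k → ℝ) → PMF ℝ} {val : R → List X → ℝ} {m T η : ℕ}

/-- The state and the transcript in a given configuration of the pools. -/
def realize (snap : (Fin k → R) → (Fin k → R) → ℕ → ℕ → List X → ℕ → A.State) (T η : ℕ)
    (c : Config X R k) : A.State × Transcript X :=
  (snap c.1 c.2.1 c.2.2.activeStart c.2.2.nextStart c.2.2.trans.updates
    (c.2.2.trans.queries / η % T), c.2.2.trans)

variable {snap : (Fin k → R) → (Fin k → R) → ℕ → ℕ → List X → ℕ → A.State}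

/-- The memory is a function of the two pools and the public record, and every step preserves this.
The advice counter is the number of query blocks of length `η` modulo `T`, so the `T`-th bit arrives
exactly when the pools rotate, every `η * T` queries. -/
theorem round_realize (hT : 0 < T) (hη : 0 < η)
    (hupdate : ∀ ρ ρ' i i' x t a, i ≤ x.length → i' ≤ x.length →
      A.update (snap ρ ρ' i i' x t) a = PMF.pure (snap ρ ρ' i i' (x ++ [a]) t))
    (hanswer : ∀ ρ ρ' i i' x t, x.length ≤ m →
      A.answer (snap ρ ρ' i i' x t) =
        (mech fun j => val (ρ j) x).map fun z => (z, snap ρ ρ' i i' x t))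
    (hreceive : ∀ ρ ρ' i i' x t, t < T → i' ≤ m →
      A.receive (snap ρ ρ' i i' x t) (A.predicate (snap ρ ρ' i i' x t) x) =
      if t + 1 = T then (iid μ k).map fun ρ'' => snap ρ' ρ'' i' x.length x 0
      else PMF.pure (snap ρ ρ' i i' x (t + 1)))
    (B : Adversary X) {c : Config X R k}
    (h1 : c.2.2.activeStart ≤ c.2.2.nextStart) (h2 : c.2.2.nextStart ≤ c.2.2.trans.length)
    (h3 : c.2.2.trans.length + 1 ≤ m) :
    A.round η B (realize snap T η c) =
      (poolRound μ (η * T) B (poolAnswer mech val) c).map (realize snap T η) := by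
  obtain ⟨ρ, ρ', ⟨i, i', h⟩⟩ := c
  simp only at h1 h2 h3
  have hlen := Transcript.length_updates h
  simp only [ASAAlgorithm.round, poolRound, PMF.map_bind]
  refine congrArg _ (funext fun p => ?_)
  simp only [realize]
  rw [hupdate ρ ρ' _ _ _ _ _ (by omega) (by omega), PMF.pure_bind]
  by_cases hp : p.2 = true
  · rw [if_pos hp, if_pos hp, hanswer ρ ρ' _ _ _ _ (by simp; omega), PMF.bind_map,
      PMF.map_bind]
    refine congrArg _ (funext fun z => ?_)
    simp only [Function.comp_apply, Record.push, settle, Record.rotate,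
      Transcript.queries_append_some, Transcript.updates_append]
    by_cases hq : (h.queries + 1) % η = 0
    · have hdiv : (h.queries + 1) / η = h.queries / η + 1 := by
        rw [Nat.succ_div, if_pos (Nat.dvd_of_mod_eq_zero hq)]
      have ht := Nat.mod_lt (h.queries / η) hT
      have hmod : (h.queries / η + 1) % T = (h.queries / η % T + 1) % T := by
        rw [Nat.mod_add_mod]
      have hmul : (h.queries + 1) % (η * T) = η * ((h.queries / η + 1) % T) := by
        rw [Nat.mod_mul, hq, zero_add, hdiv]
      rw [if_pos hq, hreceive ρ ρ' _ _ _ _ ht (by omega)]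
      by_cases hrot : h.queries / η % T + 1 = T
      · rw [hrot, Nat.mod_self] at hmod
        rw [hmod, mul_zero] at hmul
        rw [if_pos hrot, if_pos hmul, PMF.map_comp, PMF.map_comp]
        congr 1
        funext ρ''
        simp [realize, Transcript.queries_append_some, Transcript.updates_append, hdiv, hmod, hlen]
      · rw [Nat.mod_eq_of_lt (show h.queries / η % T + 1 < T by omega)] at hmod
        have hne : (h.queries + 1) % (η * T) ≠ 0 := by
          rw [hmul, hmod]
          positivity
        rw [if_neg hrot, if_neg hne, PMF.pure_map, PMF.pure_map]
        simp [realize, Transcript.queries_append_some, Transcript.updates_append, hdiv, hmod]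
    · have hdiv : (h.queries + 1) / η = h.queries / η := by
        rw [Nat.succ_div, if_neg (fun hd => hq (Nat.mod_eq_zero_of_dvd hd)), add_zero]
      have hrot : (h.queries + 1) % (η * T) ≠ 0 := fun hd =>
        hq (Nat.mod_eq_zero_of_dvd ((Dvd.intro _ rfl).trans (Nat.dvd_of_mod_eq_zero hd)))
      rw [if_neg hq, if_neg hrot, PMF.pure_map]
      simp [realize, Transcript.queries_append_some, Transcript.updates_append, hdiv]
  · rw [if_neg hp, if_neg hp, PMF.pure_map]
    simp [realize, Record.push, Transcript.queries_append_none, Transcript.updates_append]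

theorem play_realize (hT : 0 < T) (hη : 0 < η)
    (hinit : A.init = (iid μ k).bind fun ρ => (iid μ k).map fun ρ' => snap ρ ρ' 0 0 [] 0)
    (hupdate : ∀ ρ ρ' i i' x t a, i ≤ x.length → i' ≤ x.length →
      A.update (snap ρ ρ' i i' x t) a = PMF.pure (snap ρ ρ' i i' (x ++ [a]) t))
    (hanswer : ∀ ρ ρ' i i' x t, x.length ≤ m →
      A.answer (snap ρ ρ' i i' x t) =
        (mech fun j => val (ρ j) x).map fun z => (z, snap ρ ρ' i i' x t))
    (hreceive : ∀ ρ ρ' i i' x t, t < T → i' ≤ m →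
      A.receive (snap ρ ρ' i i' x t) (A.predicate (snap ρ ρ' i i' x t) x) =
      if t + 1 = T then (iid μ k).map fun ρ'' => snap ρ' ρ'' i' x.length x 0
      else PMF.pure (snap ρ ρ' i i' x (t + 1)))
    (B : Adversary X) {n : ℕ} (hn : n ≤ m) :
    A.play η B n = (poolPlay μ (η * T) B (poolAnswer mech val) n).map (realize snap T η) := by
  induction n with
  | zero =>
    simp only [ASAAlgorithm.play, poolPlay, hinit, PMF.map_bind, PMF.map_comp]
    refine congrArg _ (funext fun ρ => ?_)
    congr 1
    funext ρ'
    simp [realize, Transcript.queries, Transcript.updates]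
  | succ n ih =>
    rw [ASAAlgorithm.play, ih (by omega), poolPlay, PMF.bind_map, PMF.map_bind]
    refine bind_congr_support fun c hc => ?_
    obtain ⟨h1, h2, h3⟩ := poolPlay_support hc
    exact round_realize hT hη hupdate hanswer hreceive B h1 h2 (by omega)

end Refinement

theorem play_poolAlgorithm {X : Type*} {A : SegmentedAlgorithm X} {k b m η : ℕ}
    {enc : A.SV → Fin b → Bool} {mech : (Fin k → ℝ) → PMF ℝ} {dec : (Fin b → Bool) → A.SV}
    (hA : A.IsLinearState m) (hdec : ∀ v, dec (enc v) = v) (hη : 0 < η)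
    (hkb : 0 < k * b) (B : Adversary X) {n : ℕ} (hn : n ≤ m) :
    (poolAlgorithm A m enc mech dec).play η B n =
      (poolPlay A.coins (η * (k * b)) B (poolAnswer mech A.output) n).map
        (realize (A := poolAlgorithm A m enc mech dec) (snapshot A m enc) (k * b) η) :=
  play_realize hkb hη rfl
    (fun ρ ρ' _ _ _ t a hi hi' => poolAlgorithm_update A ρ ρ' t hi hi' a)
    (fun ρ ρ' _ _ _ t hx => poolAlgorithm_answer A hA ρ ρ' t hx)
    (fun ρ ρ' _ _ _ _ ht hi' => poolAlgorithm_receive A hdec ρ ρ' ht hi') B hn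

/-! ### Trivial algorithms for degenerate parameters -/

section Deterministic

variable {X : Type*}

/-- An algorithm that uses neither randomness nor advice. -/
noncomputable def deterministicAlgorithm (S : Type) [Fintype S] (s₀ : S) (upd : S → X → S)
    (ans : S → ℝ) : ASAAlgorithm X where
  State := S
  init := PMF.pure s₀
  update σ x := PMF.pure (upd σ x)
  answer σ := PMF.pure (ans σ, σ)
  predicate _ _ := false
  receive σ _ := PMF.pure σ

theorem space_deterministicAlgorithm (S : Type) [Fintype S] (s₀ : S) (upd : S → X → S)
    (ans : S → ℝ) :
    (deterministicAlgorithm S s₀ upd ans).space = Nat.clog 2 (Fintype.card S) := rfl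

theorem isRobust_of_deterministic (A : ASAAlgorithm X) {s₀ : A.State} {upd : A.State → X → A.State}
    {ans : A.State → ℝ} (hinit : A.init = PMF.pure s₀)
    (hupd : ∀ σ x, A.update σ x = PMF.pure (upd σ x))
    (hans : ∀ σ, A.answer σ = PMF.pure (ans σ, σ))
    (hrec : ∀ σ a, A.receive σ a = PMF.pure σ) {g : List X → ℝ} {m T η : ℕ} {α β : ℝ} (hβ : 0 ≤ β)
    (h : ∀ x : List X, x ≠ [] → x.length ≤ m → Accurate α (g x) (ans (x.foldl upd s₀))) :
    A.IsRobust g m T η α β := by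
  intro B _
  have key : ∀ n ≤ m, ∀ c ∈ (A.play η B n).support,
      c.1 = c.2.updates.foldl upd s₀ ∧ c.2.length = n ∧ c.2.AllAccurate g α := by
    intro n
    induction n with
    | zero =>
      intro _ c hc
      rw [ASAAlgorithm.play, hinit, PMF.pure_map, PMF.mem_support_pure_iff] at hc
      subst hc
      exact ⟨rfl, rfl, fun i hi => by simp at hi⟩
    | succ n ih =>
      intro hn c hc
      rw [ASAAlgorithm.play, PMF.mem_support_bind_iff] at hc
      obtain ⟨c₀, hc₀, hc⟩ := hc
      obtain ⟨h1, h2, h3⟩ := ih (by omega) c₀ hc₀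
      rw [ASAAlgorithm.round, PMF.mem_support_bind_iff] at hc
      obtain ⟨p, -, hc⟩ := hc
      have hfold : (c₀.2.updates ++ [p.1]).foldl upd s₀ = upd c₀.1 p.1 := by
        rw [List.foldl_append, ← h1]
        rfl
      rw [hupd, PMF.pure_bind] at hc
      split_ifs at hc
      · have hc' : c = (upd c₀.1 p.1, c₀.2 ++ [(p.1, some (ans (upd c₀.1 p.1)))]) := by
          rw [hans, PMF.pure_bind] at hc
          simp only [hrec, PMF.pure_map, ite_self] at hc
          exact (PMF.mem_support_pure_iff _ _).1 hc
        subst hc'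
        refine ⟨?_, by simp [h2], h3.append fun z hz => ?_⟩
        · rw [Transcript.updates_append, hfold]
        · obtain rfl : ans (upd c₀.1 p.1) = z := by simpa using hz
          rw [← hfold]
          refine h _ (by simp) ?_
          simp [Transcript.length_updates, h2]
          omega
      · rw [PMF.mem_support_pure_iff] at hc
        subst hc
        refine ⟨?_, by simp [h2], h3.append fun z hz => by simp at hz⟩
        rw [Transcript.updates_append, hfold]
  have hone : (A.play η B m).toOuterMeasure {c | Transcript.AllAccurate g α c.2} = 1 := by
    rw [PMF.toOuterMeasure_apply_eq_one_iff]
    exact fun c hc => (key m le_rfl c hc).2.2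
  rw [hone]
  exact ENNReal.ofReal_le_one.2 (by linarith)

theorem isRobust_deterministicAlgorithm {S : Type} [Fintype S] {s₀ : S} {upd : S → X → S}
    {ans : S → ℝ} {g : List X → ℝ} {m T η : ℕ} {α β : ℝ} (hβ : 0 ≤ β)
    (h : ∀ x : List X, x ≠ [] → x.length ≤ m → Accurate α (g x) (ans (x.foldl upd s₀))) :
    (deterministicAlgorithm S s₀ upd ans).IsRobust g m T η α β :=
  isRobust_of_deterministic (deterministicAlgorithm S s₀ upd ans) rfl (fun _ _ => rfl)
    (fun _ => rfl) (fun _ _ => rfl) hβ h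

/-- If a constant is accurate for all streams, no memory is needed. -/
theorem exists_constant_algorithm {g : List X → ℝ} {m : ℕ} {α β : ℝ} (hβ : 0 ≤ β) (z : ℝ)
    (h : ∀ x : List X, x ≠ [] → x.length ≤ m → Accurate α (g x) z) :
    ∃ A : ASAAlgorithm X, A.space = 0 ∧ ∀ T η, A.IsRobust g m T η α β :=
  ⟨deterministicAlgorithm Unit () (fun _ _ => ()) fun _ => z, by
    simp [space_deterministicAlgorithm],
    fun T η => isRobust_deterministicAlgorithm hβ h⟩

theorem card_lists_le [Fintype X] {m N : ℕ} (hN : 1 ≤ N) (hX : Fintype.card X ≤ N) :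
    Nat.card {l : List X // l.length ≤ m} ≤ (m + 1) * N ^ m := by
  let φ : {l : List X // l.length ≤ m} → Σ i : Fin (m + 1), List.Vector X i :=
    fun l => ⟨⟨l.1.length, by have := l.2; omega⟩, l.1, rfl⟩
  have hφ : Function.Injective φ := by
    rintro ⟨l, hl⟩ ⟨l', hl'⟩ h
    have h2 : ∀ p q : Σ i : Fin (m + 1), List.Vector X i, p = q → p.2.1 = q.2.1 := by
      rintro p q rfl
      rfl
    exact Subtype.ext (h2 _ _ h)
  refine (Nat.card_le_card_of_injective φ hφ).trans ?_
  rw [Nat.card_eq_fintype_card, Fintype.card_sigma]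
  simp only [card_vector]
  calc ∑ i : Fin (m + 1), Fintype.card X ^ i.val ≤ ∑ _i : Fin (m + 1), N ^ m := by
        refine Finset.sum_le_sum fun i _ => ?_
        exact (Nat.pow_le_pow_left hX _).trans (Nat.pow_le_pow_right hN (by omega))
    _ = _ := by simp

/-- The algorithm that stores the whole stream. -/
theorem exists_storing_algorithm [Fintype X] {g : List X → ℝ} {m N : ℕ} {α β : ℝ} (hα : 0 ≤ α)
    (hβ : 0 ≤ β) (hN : 1 ≤ N) (hX : Fintype.card X ≤ N) :
    ∃ A : ASAAlgorithm X, A.space ≤ Nat.clog 2 ((m + 1) * N ^ m) ∧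
      ∀ T η, A.IsRobust g m T η α β := by
  have hfin : Finite {l : List X // l.length ≤ m} := List.finite_length_le X m
  let e := Finite.equivFin {l : List X // l.length ≤ m}
  let upd : Fin (Nat.card {l : List X // l.length ≤ m}) → X →
      Fin (Nat.card {l : List X // l.length ≤ m}) := fun σ a =>
    if h : (e.symm σ).1.length + 1 ≤ m then e ⟨(e.symm σ).1 ++ [a], by simpa using h⟩ else σ
  have hfold : ∀ x : List X, x.length ≤ m →
      (e.symm (x.foldl upd (e ⟨[], by simp⟩))).1 = x := by
    intro x
    induction x using List.reverseRecOn with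
    | nil => simp
    | append_singleton x a ih =>
      intro hx
      simp only [List.length_append, List.length_cons, List.length_nil, zero_add] at hx
      have h1 := ih (by omega)
      rw [List.foldl_append, List.foldl_cons, List.foldl_nil]
      have h2 : ∀ σ, (h : (e.symm σ).1.length + 1 ≤ m) →
          upd σ a = e ⟨(e.symm σ).1 ++ [a], by simpa using h⟩ := fun σ h => dif_pos h
      rw [h2 _ (by rw [h1]; exact hx)]
      simp only [Equiv.symm_apply_apply, h1]
  refine ⟨deterministicAlgorithm _ (e ⟨[], by simp⟩) upd fun σ => g (e.symm σ).1, ?_, fun T η =>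
    isRobust_deterministicAlgorithm hβ fun x _ hx => ?_⟩
  · rw [space_deterministicAlgorithm, Fintype.card_fin]
    refine Nat.clog_mono_right 2 ?_
    exact card_lists_le hN hX
  · rw [hfold x hx]
    simp only [Accurate, sub_self, abs_zero]
    positivity

end Deterministic

/-! ### Consequences of the oblivious guarantee -/

section Oblivious

variable {X : Type*} {A : SegmentedAlgorithm X}

/-- An oblivious algorithm gives an inaccurate response to a fixed stream with small probability. -/
theorem SegmentedAlgorithm.IsOblivious.expect_le {g : List X → ℝ} {m : ℕ} {α β : ℝ}
    (h : A.IsOblivious g m α β) {x : List X} (hx : x ≠ []) (hxm : x.length ≤ m) :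
    expect A.coins ({r | ¬ Accurate α (g x) (A.output r x)}.indicator 1) ≤ ENNReal.ofReal β := by
  obtain ⟨a, x', rfl⟩ := List.exists_cons_of_ne_nil hx
  set x := a :: x' with hxdef
  -- The guarantee is for streams of length exactly `m`, so `x` is padded with copies of its first
  -- letter; nonemptiness of `x` provides the letter.
  have h1 := h (x ++ List.replicate (m - x.length) a) (by simp; omega)
  rw [toOuterMeasure_eq_expect] at h1
  have h2 : ∀ r, ({r | ∀ i, 1 ≤ i → i ≤ m →
      Accurate α (g ((x ++ List.replicate (m - x.length) a).take i))
        (A.output r ((x ++ List.replicate (m - x.length) a).take i))}.indicator 1 r : ℝ≥0∞) +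
      {r | ¬ Accurate α (g x) (A.output r x)}.indicator 1 r ≤ 1 := by
    intro r
    by_cases hr : Accurate α (g x) (A.output r x)
    · rw [Set.indicator_of_notMem (s := {r | ¬ Accurate α (g x) (A.output r x)})
        (fun h => h hr), add_zero]
      exact Set.indicator_le_self' (fun _ _ => zero_le) _
    · rw [Set.indicator_of_notMem, zero_add]
      · exact Set.indicator_le_self' (fun _ _ => zero_le) _
      · intro hmem
        have := hmem x.length (by simp [hxdef]) hxm
        rw [List.take_left' rfl] at this
        exact hr this
  have h3 := (expect_mono (P := A.coins) h2).trans (expect_const _ _).le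
  rw [expect_add] at h3
  have h4 : ENNReal.ofReal (1 - β) + ENNReal.ofReal β ≥ 1 := by
    rw [ge_iff_le, ← ENNReal.ofReal_one, ← sub_add_cancel 1 β]
    simpa using ENNReal.ofReal_add_le (p := 1 - β) (q := β)
  refine (ENNReal.add_le_add_iff_left (a := ENNReal.ofReal (1 - β)) ENNReal.ofReal_ne_top).1 ?_
  exact ((add_le_add h1 le_rfl).trans h3).trans h4

theorem SegmentedAlgorithm.card_le_of_space_le {s : ℕ} (h : A.space ≤ s) :
    Fintype.card A.SR * (Fintype.card A.SV * Fintype.card A.SC) ≤ 2 ^ s := by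
  rw [← Fintype.card_prod, ← Fintype.card_prod]
  exact (Nat.clog_le_iff_le_pow (by norm_num)).1 h

/-- An algorithm without memory gives a constant response. -/
theorem exists_constant_of_space_eq_zero {g : List X → ℝ} {m : ℕ} {α β : ℝ}
    (hβ1 : β < 1) (h : A.IsOblivious g m α β) (hs : A.space = 0) :
    ∃ z, ∀ x : List X, x ≠ [] → x.length ≤ m → Accurate α (g x) z := by
  obtain ⟨r₀, -⟩ := A.coins.support_nonempty
  have hcard : Fintype.card (A.SR × A.SV × A.SC) ≤ 1 := by
    have := SegmentedAlgorithm.card_le_of_space_le hs.le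
    simpa [Fintype.card_prod] using this
  have hsub := Fintype.card_le_one_iff_subsingleton.1 hcard
  refine ⟨A.respond r₀ (A.vec (A.initV r₀)), fun x hx hxm => ?_⟩
  have hout : ∀ r, A.output r x = A.respond r₀ (A.vec (A.initV r₀)) := by
    intro r
    have := hsub.elim (r, (A.run r (x.map fun a => (a, true))).1,
      (A.run r (x.map fun a => (a, true))).2) (r₀, A.initV r₀, A.initC r₀)
    simp only [Prod.mk.injEq] at this
    unfold SegmentedAlgorithm.output SegmentedAlgorithm.Sv
    rw [this.2.1, this.1]
  by_contra hacc
  have h1 := h.expect_le hx hxm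
  have h2 : expect A.coins ({r | ¬ Accurate α (g x) (A.output r x)}.indicator 1) = 1 := by
    rw [← expect_const A.coins 1]
    congr 1
    funext r
    rw [Set.indicator_of_mem]
    · rfl
    · rw [Set.mem_ofPred_eq, hout r]
      exact hacc
  rw [h2, ENNReal.one_le_ofReal] at h1
  linarith

end Oblivious

/-! ### Choice of parameters -/

section Parameters

/-- The binomial ratio is at most `(100/42) ^ l`, since `43κ + 1 - l ≥ 42κ`; and `(100/42)·(7/20) =
5/6`. -/
theorem choose_mul_pow_le {κ l : ℕ} (hl : l ≤ κ) :
    ((100 * κ).choose l : ℝ) * (7 / 20) ^ l ≤ (5 / 6) ^ l * ((43 * κ).choose l : ℝ) := by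
  have h1 : (l.factorial : ℝ) * (100 * κ).choose l ≤ (100 * κ : ℝ) ^ l := by
    have := Nat.descFactorial_le_pow (100 * κ) l
    rw [Nat.descFactorial_eq_factorial_mul_choose] at this
    exact_mod_cast this
  have h2 : (42 * κ : ℝ) ^ l ≤ l.factorial * (43 * κ).choose l := by
    have h3 := Nat.pow_sub_le_descFactorial (43 * κ) l
    rw [Nat.descFactorial_eq_factorial_mul_choose] at h3
    have h4 : (42 * κ) ^ l ≤ (43 * κ + 1 - l) ^ l := Nat.pow_le_pow_left (by omega) l
    exact_mod_cast h4.trans h3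
  have hpos : (0 : ℝ) < l.factorial := by exact_mod_cast l.factorial_pos
  refine le_of_mul_le_mul_left ?_ hpos
  calc (l.factorial : ℝ) * ((100 * κ).choose l * (7 / 20) ^ l)
      = (l.factorial * (100 * κ).choose l) * (7 / 20) ^ l := by ring
    _ ≤ (100 * κ : ℝ) ^ l * (7 / 20) ^ l := by gcongr
    _ = (5 / 6) ^ l * (42 * κ : ℝ) ^ l := by
        rw [← mul_pow, ← mul_pow]
        congr 1
        ring
    _ ≤ (5 / 6) ^ l * (l.factorial * (43 * κ).choose l) := by gcongr
    _ = _ := by ring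

/-- With `x ^ l = exp u` and `θ = u ^ 2` this bounds the loss per query: it is quadratic in `u`,
because `exp u + u² - 1 ≤ 3u/2`. -/
theorem exp_add_sq_le {u : ℝ} (hu0 : 0 ≤ u) (hu : u ≤ 1 / 4) :
    Real.exp u + u ^ 2 ≤ 2 ∧ 1 + (Real.exp u + u ^ 2 - 1) ^ 2 + u ^ 2 ≤ Real.exp (4 * u ^ 2) := by
  have h1 : Real.exp u ≤ 1 + u + u ^ 2 := by
    have := Real.abs_exp_sub_one_sub_id_le (x := u) (by rw [abs_of_nonneg hu0]; linarith)
    have := (abs_le.1 this).2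
    linarith
  have h0 : 1 + u ≤ Real.exp u := by
    have := Real.add_one_le_exp u
    linarith
  refine ⟨by nlinarith, ?_⟩
  have h2 : Real.exp u + u ^ 2 - 1 ≤ 3 / 2 * u := by nlinarith
  have h3 : (Real.exp u + u ^ 2 - 1) ^ 2 ≤ (3 / 2 * u) ^ 2 :=
    pow_le_pow_left₀ (by nlinarith) h2 2
  have h4 := Real.add_one_le_exp (4 * u ^ 2)
  nlinarith [sq_nonneg u]

/-- The value `49/40` makes `exp (1/5) / 10` at most the perfect square `(7/20)²`. -/
theorem exp_fifth_le : Real.exp (1 / 5) ≤ 49 / 40 := by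
  have h1 : Real.exp (1 / 5) ^ 5 = Real.exp 1 := by
    rw [← Real.exp_nat_mul]
    norm_num
  have h2 := Real.exp_one_lt_d9
  refine le_of_pow_le_pow_left₀ (n := 5) (by norm_num) (by norm_num) ?_
  rw [h1]
  norm_num at h2 ⊢
  linarith

theorem exists_encoding {V : Type*} [Fintype V] [Nonempty V] {s : ℕ}
    (h : Fintype.card V ≤ 2 ^ s) :
    ∃ (enc : V → Fin s → Bool) (dec : (Fin s → Bool) → V), ∀ v, dec (enc v) = v := by
  have : Fintype.card V ≤ Fintype.card (Fin s → Bool) := by simpa using h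
  obtain ⟨f⟩ := Function.Embedding.nonempty_of_card_le this
  exact ⟨f, Function.invFun f, Function.leftInverse_invFun f.injective⟩

/-- In units of `k * s` bits: two for the active pool, which has an additional prefix vector, and
one each for the next pool, the advice bits and the three counters. -/
theorem card_poolState_le {X : Type*} {A : SegmentedAlgorithm X} {s k m : ℕ}
    (hs : A.space ≤ s) (hm : m + 1 ≤ 2 ^ (k * s)) :
    Fintype.card (PoolState A k s m) ≤ 2 ^ (7 * (k * s)) := by
  have hcard := SegmentedAlgorithm.card_le_of_space_le hs
  obtain ⟨r₀, -⟩ := A.coins.support_nonempty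
  have hR : 0 < Fintype.card A.SR := Fintype.card_pos_iff.2 ⟨r₀⟩
  have hC : 0 < Fintype.card A.SC := Fintype.card_pos_iff.2 ⟨A.initC r₀⟩
  have hV : Fintype.card A.SV ≤ 2 ^ s := by
    refine le_trans ?_ hcard
    calc Fintype.card A.SV ≤ Fintype.card A.SV * Fintype.card A.SC :=
          Nat.le_mul_of_pos_right _ hC
      _ ≤ _ := Nat.le_mul_of_pos_left _ hR
  have hT : k * s + 1 ≤ 2 ^ (k * s) := Nat.lt_two_pow_self
  simp only [PoolState, Fintype.card_prod, Fintype.card_fun, Fintype.card_fin, Fintype.card_bool]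
  have h1 : (Fintype.card A.SR * (Fintype.card A.SV *
      (Fintype.card A.SV * Fintype.card A.SC))) ^ k ≤ 2 ^ (2 * (k * s)) := by
    calc _ = (Fintype.card A.SV * (Fintype.card A.SR *
          (Fintype.card A.SV * Fintype.card A.SC))) ^ k := by ring
      _ ≤ (2 ^ s * 2 ^ s) ^ k := Nat.pow_le_pow_left (Nat.mul_le_mul hV hcard) k
      _ = _ := by rw [← pow_add, ← pow_mul]; congr 1; ring
  have h2 : (Fintype.card A.SR * (Fintype.card A.SV * Fintype.card A.SC)) ^ k ≤ 2 ^ (k * s) := by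
    calc _ ≤ (2 ^ s) ^ k := Nat.pow_le_pow_left hcard k
      _ = _ := by rw [← pow_mul, mul_comm]
  calc _ ≤ 2 ^ (2 * (k * s)) * (2 ^ (k * s) * (2 ^ (k * s) * (2 ^ (k * s) *
        (2 ^ (k * s) * 2 ^ (k * s))))) := by gcongr
    _ = 2 ^ (7 * (k * s)) := by
        rw [← pow_add, ← pow_add, ← pow_add, ← pow_add, ← pow_add]
        congr 1
        ring

open Classical in
-- The two numerical hypotheses split the failure probability: `h₁` pays for too many bad samples,
-- `h₂` for responses that are not interior points.
theorem exists_robust_of_parameters {X : Type*} {A : SegmentedAlgorithm X} {g : List X → ℝ}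
    {m η s l : ℕ} {α β u : ℝ} (hA : A.IsLinearState m) (hobl : A.IsOblivious g m α (1 / 10))
    (hspace : A.space ≤ s) (hs : 1 ≤ s) (hη : 1 ≤ η) (hl : 1 ≤ l) (hβ : 0 < β)
    (hu : u = 1 / (40000 * l * η * s)) (hml : m + 1 ≤ 2 ^ l)
    (h₁ : (m : ℝ) * ((m + 1) * (5 / 6) ^ l) ≤ β / 2)
    (h₂ : (m : ℝ) * (200 * (s + 1) * Real.exp u / u ^ 2 / Real.exp (60 * l)) ≤ β / 2) :
    ∃ A' : ASAAlgorithm X, A'.space ≤ 560000000 * (l ^ 3 * η * s ^ 2) ∧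
      ∀ T, A'.IsRobust g m T η α β := by
  -- The choices of `κ` and `u` balance two demands: `3κ·u/l = 60·l`, so that the failure symbol is
  -- rare, and `4u²·Q = l/5` for an epoch of `Q = η·100κ·s` queries.
  obtain ⟨κ, hκ⟩ : ∃ κ, κ = 800000 * (l ^ 3 * η * s) := ⟨_, rfl⟩
  have hls : l ≤ l ^ 3 * η * s := by
    calc l = l ^ 1 * 1 * 1 := by ring
      _ ≤ l ^ 3 * η * s := by
        gcongr
        omega
  have hκ0 : 0 < κ := by omega
  have hl' : (1 : ℝ) ≤ l := by exact_mod_cast hl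
  have hs' : (1 : ℝ) ≤ s := by exact_mod_cast hs
  have hη' : (1 : ℝ) ≤ η := by exact_mod_cast hη
  have hden : (1 : ℝ) ≤ l * η * s := by
    have := one_le_mul_of_one_le_of_one_le hl' hη'
    exact one_le_mul_of_one_le_of_one_le this hs'
  have hu0 : 0 < u := by rw [hu]; positivity
  have hu1 : u ≤ 1 / 4 := by
    rw [hu]
    apply one_div_le_one_div_of_le <;> nlinarith
  obtain ⟨hx2, ha⟩ := exp_add_sq_le hu0.le hu1
  obtain ⟨x, hx⟩ : ∃ x, x = Real.exp (u / l) := ⟨_, rfl⟩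
  have hx1 : 1 ≤ x := by
    rw [hx]
    exact Real.one_le_exp (by positivity)
  have hxl : x ^ l = Real.exp u := by
    rw [hx, ← Real.exp_nat_mul]
    congr 1
    field_simp
  have hxκ : x ^ (3 * κ) = Real.exp (60 * l) := by
    rw [hx, ← Real.exp_nat_mul, hκ, hu]
    congr 1
    push_cast
    field_simp
    norm_num
  have hcard := SegmentedAlgorithm.card_le_of_space_le hspace
  obtain ⟨r₀, -⟩ := A.coins.support_nonempty
  have hR : 0 < Fintype.card A.SR := Fintype.card_pos_iff.2 ⟨r₀⟩
  have hC : 0 < Fintype.card A.SC := Fintype.card_pos_iff.2 ⟨A.initC r₀⟩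
  have hRV : Fintype.card A.SR * Fintype.card A.SV ≤ 2 ^ s := by
    refine le_trans ?_ hcard
    rw [← mul_assoc]
    exact Nat.le_mul_of_pos_right _ hC
  have hSV : Fintype.card A.SV ≤ 2 ^ s := (Nat.le_mul_of_pos_left _ hR).trans hRV
  have hne : Nonempty A.SV := ⟨A.initV r₀⟩
  obtain ⟨enc, dec, hdec⟩ := exists_encoding hSV
  let V : Finset ℝ := Finset.univ.image fun p : A.SR × A.SV => A.respond p.1 (A.vec p.2)
  have hVcard : V.card < 2 ^ (s + 1) := by
    refine lt_of_le_of_lt (Finset.card_image_le.trans ?_)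
      (Nat.pow_lt_pow_right (by norm_num) (Nat.lt_succ_self s))
    rw [Finset.card_univ, Fintype.card_prod]
    exact hRV
  have hval : ∀ r y, A.output r y ∈ V := fun r y =>
    Finset.mem_image.2 ⟨(r, (A.run r (y.map fun a => (a, true))).1), Finset.mem_univ _, rfl⟩
  -- All outputs lie in a set of at most `2 ^ s` values, so a tree of depth `s + 1` suffices. `W` is
  -- chosen to give equality in `200·S·x ^ l ≤ θ·W`.
  obtain ⟨mech, mech', hindep, hdom, hutil⟩ := exists_mechanism (S := s + 1) (κ := κ) (l := l)
    (x := x) (W := 200 * (s + 1) * Real.exp u / u ^ 2) (θ := u ^ 2) V hVcard hκ0 (by omega) hx1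
    (by positivity) (by positivity) (by
      rw [hxl]
      push_cast
      field_simp
      exact le_rfl) (by rw [hxl]; exact hx2)
  rw [hxl] at hdom
  rw [hxκ] at hutil
  have hks : l ≤ 100 * κ * s := by nlinarith
  refine ⟨poolAlgorithm A m enc mech dec, ?_, fun T B _ => ?_⟩
  · refine (Nat.clog_le_iff_le_pow (by norm_num)).2 ?_
    refine (card_poolState_le hspace (hml.trans (Nat.pow_le_pow_right (by norm_num) hks))).trans
      (le_of_eq ?_)
    rw [hκ]
    congr 1
    ring
  · rw [play_poolAlgorithm hA hdec hη (by positivity) B le_rfl]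
    refine ofReal_one_sub_le_of_expect_compl_le hβ.le ?_
    rw [expect_map]
    have ha1 : (1 : ℝ≥0∞) ≤
        ENNReal.ofReal (1 + (Real.exp u + u ^ 2 - 1) ^ 2 + u ^ 2) := by
      rw [ENNReal.one_le_ofReal]
      have := sq_nonneg (Real.exp u + u ^ 2 - 1)
      have := sq_nonneg u
      linarith
    have hfail := expect_inaccurate_le (μ := A.coins) (B := B) (Q := η * (100 * κ * s)) (m := m)
      (α := α) (g := g) hval (by positivity) (b := ENNReal.ofReal ((7 / 20) ^ l))
      (D := ENNReal.ofReal ((5 / 6) ^ l)) (δ := ENNReal.ofReal (1 / 10)) ha1 hindep hdom hutil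
      (fun y hy hym => hobl.expect_le hy hym) (by omega) ?_ ?_ m
    · refine le_trans (le_of_eq ?_) (hfail.trans ?_)
      · refine expect_congr_support fun c hc => ?_
        have hlen := (poolPlay_support hc).2.2
        by_cases hacc : Transcript.AllAccurate g α c.2.2.trans
        · rw [if_neg (fun h => h.2 hacc), Set.indicator_of_notMem]
          exact fun h => h hacc
        · rw [if_pos ⟨hlen.le, hacc⟩, Set.indicator_of_mem]
          · rfl
          · exact hacc
      · have hm1 : (m : ℝ≥0∞) = ENNReal.ofReal m := (ENNReal.ofReal_natCast m).symm
        have hm2 : (m : ℝ≥0∞) + 1 = ENNReal.ofReal (m + 1) := by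
          rw [ENNReal.ofReal_add (by positivity) zero_le_one, ENNReal.ofReal_one, hm1]
        rw [hm2, hm1, ← ENNReal.ofReal_mul (by positivity), ← ENNReal.ofReal_add (by positivity)
          (by positivity), ← ENNReal.ofReal_mul (by positivity)]
        refine ENNReal.ofReal_le_ofReal ?_
        rw [mul_add]
        linarith
    · rw [← ENNReal.ofReal_pow (by positivity), ← ENNReal.ofReal_pow (by positivity),
        ← ENNReal.ofReal_pow (by positivity), ← ENNReal.ofReal_mul (by positivity)]
      refine ENNReal.ofReal_le_ofReal ?_
      -- The loss over a whole epoch is only `exp (l/5)`, which the probability `10⁻ˡ` outweighs.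
      calc _ ≤ Real.exp (4 * u ^ 2) ^ (η * (100 * κ * s)) * (1 / 10) ^ l := by gcongr
        _ = (Real.exp (1 / 5) / 10) ^ l := by
            have hexp : Real.exp (4 * u ^ 2) ^ (η * (100 * κ * s)) = Real.exp (1 / 5) ^ l := by
              rw [← Real.exp_nat_mul, ← Real.exp_nat_mul, hκ, hu]
              congr 1
              push_cast
              field_simp
              norm_num
            rw [hexp, ← mul_pow, mul_one_div]
        _ ≤ (49 / 400) ^ l := by
            have := exp_fifth_le
            exact pow_le_pow_left₀ (by positivity) (by linarith) l
        _ = _ := by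
            rw [← pow_mul, mul_comm l 2, pow_mul]
            norm_num
    · rw [← ENNReal.ofReal_natCast, ← ENNReal.ofReal_natCast, ← ENNReal.ofReal_mul (by positivity),
        ← ENNReal.ofReal_mul (by positivity)]
      exact ENNReal.ofReal_le_ofReal (choose_mul_pow_le (by omega))

end Parameters

/-! ### Numerical estimates -/

theorem five_sixths_pow_le {m l : ℕ} {β : ℝ} (hm : 2 ≤ m) (hβ : 0 < β) (hβ1 : β < 1)
    (hl : 30 * Real.log (m / β) ≤ l) : (m : ℝ) * ((m + 1) * (5 / 6) ^ l) ≤ β / 2 := by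
  have hm' : (2 : ℝ) ≤ m := by exact_mod_cast hm
  have hmβ : (0 : ℝ) < m / β := by positivity
  have h1 : ((5 : ℝ) / 6) ^ l ≤ (β / m) ^ 5 := by
    calc ((5 : ℝ) / 6) ^ l ≤ Real.exp (-(1 / 6)) ^ l := by
          refine pow_le_pow_left₀ (by norm_num) ?_ l
          have := Real.add_one_le_exp (-(1 / 6) : ℝ)
          linarith
      _ = Real.exp (-(l / 6)) := by
          rw [← Real.exp_nat_mul]
          congr 1
          ring
      _ ≤ Real.exp ((5 : ℕ) * -Real.log (m / β)) := by
          apply Real.exp_le_exp.2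
          push_cast
          linarith
      _ = (β / m) ^ 5 := by
          rw [Real.exp_nat_mul, Real.exp_neg, Real.exp_log hmβ, inv_div]
  have h2 : β ^ 5 ≤ β := by
    calc β ^ 5 ≤ β ^ 1 := pow_le_pow_of_le_one hβ.le hβ1.le (by norm_num)
      _ = β := pow_one β
  have h3 : 2 * (m * (m + 1) : ℝ) ≤ m ^ 5 := by
    have h4 : (8 : ℝ) ≤ m ^ 3 := by
      calc (8 : ℝ) = 2 ^ 3 := by norm_num
        _ ≤ m ^ 3 := pow_le_pow_left₀ (by norm_num) hm' 3
    have h5 : (m : ℝ) ^ 5 = m ^ 3 * m ^ 2 := by ring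
    have h6 : (8 : ℝ) * m ^ 2 ≤ m ^ 3 * m ^ 2 := mul_le_mul_of_nonneg_right h4 (sq_nonneg _)
    nlinarith
  calc (m : ℝ) * ((m + 1) * (5 / 6) ^ l) ≤ m * ((m + 1) * (β / m) ^ 5) := by gcongr
    _ = m * (m + 1) * β ^ 5 / m ^ 5 := by rw [div_pow]; ring
    _ ≤ β / 2 := by
        rw [div_le_div_iff₀ (by positivity) (by norm_num)]
        calc (m : ℝ) * (m + 1) * β ^ 5 * 2 = β ^ 5 * (2 * (m * (m + 1))) := by ring
          _ ≤ β * m ^ 5 := mul_le_mul h2 h3 (by positivity) hβ.le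

/-- As `η * s ^ 2 ≤ m`, the left side is at most a constant times `l²·m³ / exp (60·l)`. Then `l² ≤
2·exp l`, `m³ ≤ β·exp l`, and the remaining `exp (58·l)` absorbs the constant. -/
theorem failure_weight_le {m l η s : ℕ} {β u : ℝ} (hm : 2 ≤ m) (hβ : 0 < β) (hβ1 : β < 1)
    (hl1 : 1 ≤ l) (hl : 30 * Real.log (m / β) ≤ l) (hs : 1 ≤ s) (hη : 1 ≤ η)
    (hηs : η * s ^ 2 ≤ m) (hu : u = 1 / (40000 * l * η * s)) :
    (m : ℝ) * (200 * (s + 1) * Real.exp u / u ^ 2 / Real.exp (60 * l)) ≤ β / 2 := by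
  have hm' : (2 : ℝ) ≤ m := by exact_mod_cast hm
  have hl' : (1 : ℝ) ≤ l := by exact_mod_cast hl1
  have hs' : (1 : ℝ) ≤ s := by exact_mod_cast hs
  have hη' : (1 : ℝ) ≤ η := by exact_mod_cast hη
  have hηs' : (η * s ^ 2 : ℝ) ≤ m := by exact_mod_cast hηs
  have hmβ : (m : ℝ) ≤ m / β := by
    rw [le_div_iff₀ hβ]
    nlinarith
  have hlog : 0 ≤ Real.log (m / β) := Real.log_nonneg (by linarith)
  have hden : (1 : ℝ) ≤ l * η * s :=
    one_le_mul_of_one_le_of_one_le (one_le_mul_of_one_le_of_one_le hl' hη') hs'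
  have hu0 : 0 < u := by rw [hu]; positivity
  have hu1 : u ≤ 1 / 2 := by
    rw [hu]
    apply one_div_le_one_div_of_le <;> nlinarith
  have hexpu : Real.exp u ≤ 2 := by
    have := Real.exp_bound_div_one_sub_of_interval hu0.le (by linarith : u < 1)
    refine this.trans ?_
    rw [div_le_iff₀ (by linarith)]
    linarith
  have hu2 : (u ^ 2)⁻¹ = 1600000000 * (l ^ 2 * η ^ 2 * s ^ 2) := by
    rw [hu, one_div, inv_pow, inv_inv]
    ring
  have hsη : (s : ℝ) * (η ^ 2 * s ^ 2) ≤ m ^ 2 := by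
    calc (s : ℝ) * (η ^ 2 * s ^ 2) ≤ (s : ℝ) ^ 2 * (η ^ 2 * s ^ 2) := by
          gcongr
          nlinarith
      _ = (η * s ^ 2 : ℝ) ^ 2 := by ring
      _ ≤ (m : ℝ) ^ 2 := by gcongr
  have hl2 : (l : ℝ) ^ 2 ≤ 2 * Real.exp l := by
    have := Real.quadratic_le_exp_of_nonneg (by positivity : (0 : ℝ) ≤ l)
    nlinarith
  have hm3 : (m : ℝ) ^ 3 ≤ β * Real.exp l := by
    have h1 : (m / β : ℝ) ^ 3 ≤ Real.exp l := by
      rw [← Real.exp_log (show (0 : ℝ) < m / β by positivity), ← Real.exp_nat_mul]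
      apply Real.exp_le_exp.2
      push_cast
      linarith
    have h2 : (m : ℝ) ^ 3 = β ^ 3 * (m / β) ^ 3 := by
      field_simp
    have h3 : β ^ 3 ≤ β := by
      calc β ^ 3 ≤ β ^ 1 := pow_le_pow_of_le_one hβ.le hβ1.le (by norm_num)
        _ = β := pow_one β
    rw [h2]
    exact mul_le_mul h3 h1 (by positivity) hβ.le
  have h58 : (5120000000000 : ℝ) ≤ Real.exp (58 * l) := by
    calc (5120000000000 : ℝ) ≤ 2 ^ 58 := by norm_num
      _ ≤ Real.exp 1 ^ 58 := by
          refine pow_le_pow_left₀ (by norm_num) ?_ 58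
          linarith [Real.add_one_le_exp (1 : ℝ)]
      _ = Real.exp 58 := by
          rw [← Real.exp_nat_mul]
          norm_num
      _ ≤ Real.exp (58 * l) := by
          apply Real.exp_le_exp.2
          linarith
  have h60 : Real.exp (60 * l) = Real.exp l * Real.exp l * Real.exp (58 * l) := by
    rw [← Real.exp_add, ← Real.exp_add]
    congr 1
    ring
  rw [div_eq_mul_inv _ (u ^ 2), hu2, mul_div_assoc', div_le_iff₀ (by positivity), h60]
  calc (m : ℝ) * (200 * (s + 1) * Real.exp u * (1600000000 * (l ^ 2 * η ^ 2 * s ^ 2)))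
      ≤ m * (200 * (s + s) * 2 * (1600000000 * (l ^ 2 * η ^ 2 * s ^ 2))) := by gcongr
    _ = 1280000000000 * (m : ℝ) * l ^ 2 * (s * (η ^ 2 * s ^ 2)) := by ring
    _ ≤ 1280000000000 * (m : ℝ) * l ^ 2 * m ^ 2 := by gcongr
    _ = 1280000000000 * (l : ℝ) ^ 2 * m ^ 3 := by ring
    _ ≤ 1280000000000 * (2 * Real.exp l) * (β * Real.exp l) := by gcongr
    _ = β / 2 * (Real.exp l * Real.exp l * 5120000000000) := by ring
    _ ≤ β / 2 * (Real.exp l * Real.exp l * Real.exp (58 * l)) := by gcongr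

theorem succ_le_two_pow {m l : ℕ} {β : ℝ} (hm : 2 ≤ m) (hβ : 0 < β) (hβ1 : β < 1)
    (hl : 30 * Real.log (m / β) ≤ l) : m + 1 ≤ 2 ^ l := by
  have hm' : (2 : ℝ) ≤ m := by exact_mod_cast hm
  have hmβ : (m : ℝ) ≤ m / β := by
    rw [le_div_iff₀ hβ]
    nlinarith
  have hlog : 0 ≤ Real.log m := Real.log_nonneg (by linarith)
  have hlog' : Real.log m ≤ Real.log (m / β) := Real.log_le_log (by positivity) hmβ
  have h2 := Real.log_two_gt_d9
  have h : (m : ℝ) + 1 ≤ 2 ^ l := by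
    calc (m : ℝ) + 1 ≤ m ^ 2 := by nlinarith
      _ = Real.exp ((2 : ℕ) * Real.log m) := by
          rw [Real.exp_nat_mul, Real.exp_log (by positivity)]
      _ ≤ Real.exp (l * Real.log 2) := by
          apply Real.exp_le_exp.2
          push_cast
          nlinarith
      _ = 2 ^ l := by rw [Real.exp_nat_mul, Real.exp_log (by norm_num)]
  exact_mod_cast h

/-- There are at most `m ^ ((c + 1) * m)` streams, and rounding `log₂ m` up costs only a constant
factor because `m ≥ 2`. -/
theorem clog_storing_le {c m : ℕ} (hm : 2 ≤ m) :
    (Nat.clog 2 ((m + 1) * (m ^ c) ^ m) : ℝ) ≤ 4 * (c + 2) * (m * Real.log m) := by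
  have hm' : (2 : ℝ) ≤ m := by exact_mod_cast hm
  have hlog2 := Real.log_two_gt_d9
  have hlog : Real.log 2 ≤ Real.log m := Real.log_le_log (by norm_num) hm'
  have hle : (m + 1) * (m ^ c) ^ m ≤ m ^ ((c + 1) * m) := by
    calc (m + 1) * (m ^ c) ^ m ≤ m ^ m * (m ^ c) ^ m := by
          gcongr
          calc m + 1 ≤ 2 ^ m := Nat.lt_two_pow_self
            _ ≤ m ^ m := Nat.pow_le_pow_left hm m
      _ = m ^ ((c + 1) * m) := by
          rw [← pow_mul, ← pow_add]
          congr 1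
          ring
  set a := Nat.clog 2 m with ha
  have hpow : (m + 1) * (m ^ c) ^ m ≤ 2 ^ (a * ((c + 1) * m)) := by
    rw [pow_mul]
    exact hle.trans (Nat.pow_le_pow_left (Nat.le_pow_clog (by norm_num) m) _)
  have h1 : Nat.clog 2 ((m + 1) * (m ^ c) ^ m) ≤ a * ((c + 1) * m) :=
    (Nat.clog_le_iff_le_pow (by norm_num)).2 hpow
  have h2 : (a : ℝ) ≤ 4 * Real.log m := by
    have h3 : 2 ^ (a - 1) < m := by
      have := Nat.pow_pred_clog_lt_self (b := 2) (by norm_num) (x := m) (by omega)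
      simpa using this
    have h4 : ((2 : ℝ) ^ (a - 1)) ≤ m := by exact_mod_cast h3.le
    have h5 := Real.log_le_log (by positivity) h4
    rw [Real.log_pow] at h5
    have h6 : (a : ℝ) ≤ (a - 1 : ℕ) + 1 := by
      have : a ≤ a - 1 + 1 := by omega
      exact_mod_cast this
    nlinarith
  have h3 : (Nat.clog 2 ((m + 1) * (m ^ c) ^ m) : ℝ) ≤ a * ((c + 1) * m) := by exact_mod_cast h1
  calc _ ≤ _ := h3
    _ ≤ 4 * Real.log m * ((c + 2) * m) := by
        gcongr
        linarith
    _ = _ := by ring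

end Streaming

/-! ### The main theorem: case distinction -/

open Streaming in
theorem mainTheorem1 (c : ℕ) :
    ∃ C : ℝ, 0 < C ∧
      ∀ (X : Type*) [Fintype X] (g : List X → ℝ) (m η s : ℕ) (α β : ℝ)
        (A : Streaming.SegmentedAlgorithm X),
        1 ≤ m → Fintype.card X ≤ m ^ c → 1 ≤ η → 0 < α → 0 < β → β < 1 →
        A.IsLinearState m → A.IsOblivious g m α (1 / 10) → A.space ≤ s →
        ∃ A' : Streaming.ASAAlgorithm X,
          (A'.space : ℝ) ≤
              C * (η * (s : ℝ) ^ 2 * Real.log (m / β) * Real.log (m / (β * α)) ^ 2) ∧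
            ∀ T : ℕ, A'.IsRobust g m T η α β := by
  -- The first summand serves the pool algorithm with `l ≤ 32·log(m/β)`, the second the algorithm
  -- that stores the stream.
  refine ⟨560000000 * 32 ^ 3 + 16 * (c + 2), by positivity, ?_⟩
  intro X _ g m η s α β A hm hX hη hα hβ hβ1 hA hobl hspace
  have hm' : (1 : ℝ) ≤ m := by exact_mod_cast hm
  have hmβ : (m : ℝ) ≤ m / β := by
    rw [le_div_iff₀ hβ]
    nlinarith
  have hL0 : 0 ≤ Real.log (m / β) := Real.log_nonneg (by linarith)
  have hnonneg : 0 ≤ (560000000 * 32 ^ 3 + 16 * (c + 2) : ℝ) *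
      (η * (s : ℝ) ^ 2 * Real.log (m / β) * Real.log (m / (β * α)) ^ 2) := by positivity
  have hconst : ∀ z, (∀ x : List X, x ≠ [] → x.length ≤ m → Accurate α (g x) z) →
      ∃ A' : Streaming.ASAAlgorithm X, (A'.space : ℝ) ≤ (560000000 * 32 ^ 3 + 16 * (c + 2) : ℝ) *
        (η * (s : ℝ) ^ 2 * Real.log (m / β) * Real.log (m / (β * α)) ^ 2) ∧
          ∀ T : ℕ, A'.IsRobust g m T η α β := by
    intro z hz
    obtain ⟨A', h1, h2⟩ := exists_constant_algorithm hβ.le z hz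
    exact ⟨A', by rw [h1]; exact_mod_cast hnonneg, fun T => h2 T η⟩
  -- For `α ≥ 1` the answer `0` is always accurate. For `α < 1` one has `log(m/β) ≤ log(m/(βα))`,
  -- and the bounds below are proved with `log(m/β)³`.
  rcases le_or_gt 1 α with hα1 | hα1
  · refine hconst 0 fun x _ _ => ?_
    rw [Accurate, zero_sub, abs_neg]
    exact le_mul_of_one_le_left (abs_nonneg _) hα1
  -- For `m = 1` the domain has at most one element, hence there is at most one nonempty stream;
  -- afterwards `log(m/β) ≥ log 2` is bounded away from zero.
  rcases hm.eq_or_lt with rfl | hm2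
  · rw [one_pow, Fintype.card_le_one_iff_subsingleton] at hX
    rcases isEmpty_or_nonempty X with hE | ⟨⟨a⟩⟩
    · refine hconst 0 fun x hx => ?_
      obtain ⟨a, -⟩ := List.exists_mem_of_ne_nil x hx
      exact hE.elim a
    · refine hconst (g [a]) fun x hx hx1 => ?_
      have hxa : x = [a] := by
        obtain ⟨b, hb⟩ := List.length_eq_one_iff.1
          (le_antisymm hx1 (List.length_pos_iff.2 hx))
        rw [hb, hX.elim b a]
      rw [hxa, Accurate, sub_self, abs_zero]
      positivity
  rcases Nat.eq_zero_or_pos s with rfl | hs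
  · obtain ⟨z, hz⟩ := exists_constant_of_space_eq_zero (by norm_num) hobl (by omega)
    exact hconst z hz
  have hm2' : (2 : ℝ) ≤ m := by exact_mod_cast hm2
  have hs' : (1 : ℝ) ≤ s := by exact_mod_cast hs
  have hη' : (1 : ℝ) ≤ η := by exact_mod_cast hη
  have hlog2 := Real.log_two_gt_d9
  have hLm : Real.log m ≤ Real.log (m / β) := Real.log_le_log (by positivity) hmβ
  have hL2 : Real.log 2 ≤ Real.log (m / β) := (Real.log_le_log (by norm_num) hm2').trans hLm
  have hLL : Real.log (m / β) ≤ Real.log (m / (β * α)) := by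
    refine Real.log_le_log (by positivity) (div_le_div_of_nonneg_left (by positivity)
      (by positivity) ?_)
    nlinarith
  have hLcube : Real.log (m / β) ^ 3 ≤ Real.log (m / β) * Real.log (m / (β * α)) ^ 2 := by
    rw [pow_succ' _ 2]
    gcongr
  -- If `m ≤ η * s ^ 2`, the whole stream fits into the allowed space, by the bound on the size of
  -- the domain. Otherwise `η` and `s` are polynomial in `m`, as the choice of `l` requires.
  rcases le_or_gt m (η * s ^ 2) with hbig | hsmall
  · obtain ⟨A', h1, h2⟩ := exists_storing_algorithm (g := g) (m := m) hα.le hβ.le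
      (Nat.one_le_pow c m hm) hX
    refine ⟨A', ?_, fun T => h2 T η⟩
    have hbig' : (m : ℝ) ≤ η * s ^ 2 := by exact_mod_cast hbig
    have hlogm : 0 ≤ Real.log m := Real.log_nonneg hm'
    have hsq : (1 : ℝ) ≤ 4 * Real.log (m / β) ^ 2 := by nlinarith
    calc (A'.space : ℝ) ≤ Nat.clog 2 ((m + 1) * (m ^ c) ^ m) := by exact_mod_cast h1
      _ ≤ 4 * (c + 2) * (m * Real.log m) := clog_storing_le hm2
      _ ≤ 4 * (c + 2) * (η * s ^ 2 * Real.log (m / β)) := by gcongr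
      _ ≤ 4 * (c + 2) * (η * s ^ 2 * Real.log (m / β)) * (4 * Real.log (m / β) ^ 2) :=
          le_mul_of_one_le_right (by positivity) hsq
      _ = 16 * (c + 2) * (η * s ^ 2 * Real.log (m / β) ^ 3) := by ring
      _ ≤ 16 * (c + 2) * (η * s ^ 2 * (Real.log (m / β) * Real.log (m / (β * α)) ^ 2)) := by
          gcongr
      _ ≤ (560000000 * 32 ^ 3 + 16 * (c + 2)) *
            (η * s ^ 2 * (Real.log (m / β) * Real.log (m / (β * α)) ^ 2)) := by
          gcongr
          linarith
      _ = _ := by ring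
  · obtain ⟨l, hl⟩ : ∃ l, l = ⌈30 * Real.log (m / β)⌉₊ := ⟨_, rfl⟩
    have hl1 : 30 * Real.log (m / β) ≤ l := by
      rw [hl]
      exact Nat.le_ceil _
    have hl2 : (l : ℝ) ≤ 32 * Real.log (m / β) := by
      have := Nat.ceil_lt_add_one (show 0 ≤ 30 * Real.log (m / β) by positivity)
      rw [← hl] at this
      linarith
    have hlpos : 1 ≤ l := by
      have : (0 : ℝ) < l := by linarith
      exact_mod_cast this
    obtain ⟨A', h1, h2⟩ := exists_robust_of_parameters hA hobl hspace hs hη hlpos hβ rfl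
      (succ_le_two_pow hm2 hβ hβ1 hl1) (five_sixths_pow_le hm2 hβ hβ1 hl1)
      (failure_weight_le hm2 hβ hβ1 hlpos hl1 hs hη hsmall.le rfl)
    refine ⟨A', ?_, h2⟩
    calc (A'.space : ℝ) ≤ 560000000 * (l ^ 3 * η * s ^ 2) := by exact_mod_cast h1
      _ ≤ 560000000 * ((32 * Real.log (m / β)) ^ 3 * η * s ^ 2) := by gcongr
      _ = 560000000 * 32 ^ 3 * (η * s ^ 2 * Real.log (m / β) ^ 3) := by ring
      _ ≤ 560000000 * 32 ^ 3 *
            (η * s ^ 2 * (Real.log (m / β) * Real.log (m / (β * α)) ^ 2)) := by gcongr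
      _ ≤ (560000000 * 32 ^ 3 + 16 * (c + 2)) *
            (η * s ^ 2 * (Real.log (m / β) * Real.log (m / (β * α)) ^ 2)) := by
          gcongr
          have : (0 : ℝ) ≤ 16 * (c + 2) := by positivity
          linarith
      _ = _ := by ring
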